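/- **Conventions.** Monoids and semirings are commutative; semirings have $0\neq1$. An idempotent semiring ($a+a=a$) is ordered by $a\le b\iff a+b=b$. For a totally ordered abelian group $G$ (written additively), $G\cup\{-\infty\}$ with addition $\max$ and multiplication $+$ is a totally ordered semifield; $\mathbb T=\mathbb R\cup\{-\infty\}$ is the case $G=\mathbb R$, and $\mathbb B=\{0,1\}$ with $1+1=1$. A totally ordered semifield $K$ carries the topology with base the sets $\{a\}$ and $[0,a]$ for $a\in K\setminus\{0\}$. A *prime* of a semiring $A$ is a congruence $P\neq A\times A$ such that $A/P$ is totally ordered and cancellative; $\kappa(P)$ is the semifield of fractions of $A/P$, and $a\mapsto|a|_P$ is the map $A\to\kappa(P)$. The prime $P$ has *trivial ideal-kernel* if $(a,0)\in P$ only for $a=0$. For a topological semiring $A$, $\operatorname{Cont}(A)$ is the set of primes $P$ of $A$ with $A/P\not\cong\mathbb B$ and $A\to\kappa(P)$ continuous. For an algebra $A$ over a totally ordered semifield $S$, $\operatorname{Cont}_S A:=\operatorname{Cont}(A)$, where $A$ has the finest semiring topology for which $S\to A$ is continuous, and $\operatorname{Cont}^\circ_S A$ is its subset of primes with trivial ideal-kernel.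 A monoid $M$ is *pseudo-cancellative* if for all $u,w\in M$ the set $\{v\in M: u=v+w\}$ is finite. The monoid semiring $S[M]$ consists of the finite sums of terms $a\chi^u$ ($a\in S$, $u\in M$). **Convergent power series.** Let $S\ne\mathbb B$ be a sub-semifield of $\mathbb T$, $M$ a pseudo-cancellative monoid and $P\in\operatorname{Cont}^\circ_S S[M]$. Let $\operatorname{Cnvg}(P)$ be the set of formal series $f=\sum_{u\in M}f_u\chi^u$, $f_u\in S$, such that for every nonzero $b\in S[M]/P$ the set $\{u:|f_u\chi^u|_P\ge b\}$ is finite. With coefficientwise addition and with product $(fg)_u=\max_{v+w=u}f_vg_w$ it is a semiring. Give it the topology whose open sets are the unions of the balls $\{g:d_P(g,f)<r\}$, $f\in\operatorname{Cnvg}(P)$, $r\in\kappa(P)\setminus\{0\}$, where $d_P(f,g)=\max\{|(f_u+g_u)\chi^u|_P: f_u\ne g_u\}$ and $d_P(f,f)=0$. Let $\iota:S[M]\to\operatorname{Cnvg}(P)$ be the inclusion and $\iota^*(Q)=(\iota\times\iota)^{-1}(Q)$ the pullback of congruences. **Comparing values.** For a totally ordered set $I$ with least element $i_0$ let $\mathbb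 R^{(I)}$ be the group of functions $I\to\mathbb R$ with well-ordered support, ordered lexicographically, and let $j:\mathbb T\to\mathbb R^{(I)}\cup\{-\infty\}$ be the inclusion of the $i_0$-factor. For $P'\in\operatorname{Cont}_S S[M]$, a *joint Hahn embedding* of $P$ and $P'$ consists of such an $I$ and injective semiring homomorphisms $\varphi:\kappa(P)\to\mathbb R^{(I)}\cup\{-\infty\}$ and $\varphi':\kappa(P')\to\mathbb R^{(I)}\cup\{-\infty\}$ with $\varphi(|s|_P)=j(s)=\varphi'(|s|_{P'})$ for all $s\in S$. We say that $P'$ satisfies $(\star)$ with respect to $P$ (and this joint Hahn embedding) if there is a nonzero $c\in S$ such that $c\,|m|_P\ge|m|_{P'}$ for every term $m\in S[M]$, that is, $j(c)\,\varphi(|m|_P)\ge\varphi'(|m|_{P'})$. **Theorem.** Let $S\neq\mathbb B$ be a sub-semifield of $\mathbb T$, $M$ a pseudo-cancellative monoid, and $P\in\operatorname{Cont}^\circ_S S[M]$. Then for every $P'\in\operatorname{Cont}_S S[M]$ there is a joint Hahn embedding of $P$ and $P'$; and, for whatever choice of a joint Hahn embedding for each $P'$, the pullback $\iota^*$ is injective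 on $\operatorname{Cont}(\operatorname{Cnvg}(P))$, and its image is exactly the set of those $P'\in\operatorname{Cont}_S S[M]$ that satisfy $(\star)$ with respect to $P$. -/

import Mathlib

noncomputable section

namespace TropCont

open scoped Topology

universe u v

/-! ### Idempotent semirings and their canonical order -/

/-- The canonical relation `a ≤ b` of an idempotent semiring: `a + b = b`. -/
def CanonLE {R : Type*} [CommSemiring R] (a b : R) : Prop := a + b = b

/-- The strict version of `CanonLE`. -/
def CanonLT {R : Type*} [CommSemiring R] (a b : R) : Prop := CanonLE a b ∧ a ≠ b

/-- The semiring `R` is additively idempotent and its canonical order is total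
(taking `a = b` gives idempotency). -/
class IsTotOrd (R : Type*) [CommSemiring R] : Prop where
  add_eq_or (a b : R) : a + b = a ∨ a + b = b

section Order

variable {R : Type*} [CommSemiring R]

theorem CanonLE.zero_le (a : R) : CanonLE 0 a := zero_add a

theorem CanonLE.trans {a b c : R} (h : CanonLE a b) (h' : CanonLE b c) : CanonLE a c := by
  unfold CanonLE at *
  rw [← h', ← add_assoc, h]

theorem CanonLE.antisymm {a b : R} (h : CanonLE a b) (h' : CanonLE b a) : a = b := by
  unfold CanonLE at *
  rw [← h', add_comm, h]

theorem CanonLE.eq_zero {a : R} (h : CanonLE a 0) : a = 0 := by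
  simpa [CanonLE] using h

theorem CanonLE.mul_left {a b : R} (h : CanonLE a b) (c : R) : CanonLE (c * a) (c * b) := by
  unfold CanonLE at *
  rw [← mul_add, h]

theorem CanonLE.mul_right {a b : R} (h : CanonLE a b) (c : R) : CanonLE (a * c) (b * c) := by
  unfold CanonLE at *
  rw [← add_mul, h]

theorem CanonLE.map {R' : Type*} [CommSemiring R'] (φ : R →+* R') {a b : R} (h : CanonLE a b) :
    CanonLE (φ a) (φ b) := by
  unfold CanonLE at *
  rw [← map_add, h]

variable [IsTotOrd R]

theorem add_idem (a : R) : a + a = a := by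
  rcases IsTotOrd.add_eq_or a a with h | h <;> exact h

theorem CanonLE.refl (a : R) : CanonLE a a := add_idem a

theorem CanonLE.total (a b : R) : CanonLE a b ∨ CanonLE b a := by
  rcases IsTotOrd.add_eq_or a b with h | h
  · exact Or.inr (by rwa [CanonLE, add_comm])
  · exact Or.inl h

theorem CanonLE.le_add_left (a b : R) : CanonLE a (a + b) := by
  rw [CanonLE, ← add_assoc, add_idem]

theorem CanonLE.le_add_right (a b : R) : CanonLE b (a + b) := by
  rw [add_comm]; exact CanonLE.le_add_left b a

theorem canonLE_add_iff {a b z : R} : CanonLE (a + b) z ↔ CanonLE a z ∧ CanonLE b z := by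
  constructor
  · intro h
    exact ⟨(CanonLE.le_add_left a b).trans h, (CanonLE.le_add_right a b).trans h⟩
  · rintro ⟨h, h'⟩
    unfold CanonLE at *
    rw [add_assoc, h', h]

theorem eq_of_forall_canonLE_iff {a b : R} (h : ∀ z, CanonLE a z ↔ CanonLE b z) : a = b :=
  ((h b).2 (CanonLE.refl b)).antisymm ((h a).1 (CanonLE.refl a))

end Order

/-- `x` is the greatest element of the set `s` for the canonical order. -/
def IsMaxOf {R : Type*} [CommSemiring R] (s : Set R) (x : R) : Prop :=
  x ∈ s ∧ ∀ y ∈ s, CanonLE y x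

open Classical in
/-- The greatest element of `s` for the canonical order; by convention `0` if there is none. In
particular it is `0`, the empty sum, for `s = ∅`. -/
def maxOf {R : Type*} [CommSemiring R] (s : Set R) : R :=
  if h : ∃ x, IsMaxOf s x then h.choose else 0

theorem maxOf_spec {R : Type*} [CommSemiring R] {s : Set R} (h : ∃ x, IsMaxOf s x) :
    IsMaxOf s (maxOf s) := by
  unfold maxOf
  rw [dif_pos h]
  exact h.choose_spec

theorem exists_isMaxOf_of_finite {R ι : Type*} [CommSemiring R] [IsTotOrd R] (F : ι → R)
    {t : Set ι} (ht : t.Finite) (hne : t.Nonempty) : ∃ i ∈ t, ∀ j ∈ t, CanonLE (F j) (F i) := by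
  induction t, ht using Set.Finite.induction_on with
  | empty => exact absurd hne (by simp)
  | @insert a t _ _ ih =>
    rcases t.eq_empty_or_nonempty with rfl | hne'
    · exact ⟨a, by simp, by simp [CanonLE.refl]⟩
    · obtain ⟨i, hi, hmax⟩ := ih hne'
      rcases CanonLE.total (F a) (F i) with h | h
      · refine ⟨i, Or.inr hi, ?_⟩
        rintro j (rfl | hj)
        · exact h
        · exact hmax j hj
      · refine ⟨a, Or.inl rfl, ?_⟩
        rintro j (rfl | hj)
        · exact CanonLE.refl _
        · exact (hmax j hj).trans h

/-! ### The totally ordered semifields `G ∪ {-∞}`, in particular `𝕋` -/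

/-- The totally ordered semifield `G ∪ {-∞}` of a totally ordered abelian group `G` (written
additively): its addition is the maximum, its multiplication is the addition of `G`, its zero is
`-∞`. The element that belongs to `a : G` is `MaxPlus.t a`. -/
def MaxPlus (G : Type*) : Type _ := WithZero (Multiplicative G)

namespace MaxPlus

variable {G : Type*} [AddCommGroup G] [LinearOrder G] [IsOrderedAddMonoid G]

instance : LinearOrderedCommGroupWithZero (MaxPlus G) :=
  inferInstanceAs (LinearOrderedCommGroupWithZero (WithZero (Multiplicative G)))

/-- Sums are maxima. -/
instance : Add (MaxPlus G) := ⟨max⟩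

theorem add_def (a b : MaxPlus G) : a + b = max a b := rfl

instance : CommSemiring (MaxPlus G) where
  __ := (inferInstance : CommMonoidWithZero (MaxPlus G))
  add_assoc a b c := max_assoc a b c
  zero_add a := max_eq_right zero_le
  add_zero a := max_eq_left zero_le
  add_comm a b := max_comm a b
  left_distrib a b c := mul_max a b c
  right_distrib a b c := max_mul a b c
  nsmul := nsmulRec

/-- The canonical order of the semiring is the given order. -/
theorem canonLE_iff (a b : MaxPlus G) : CanonLE a b ↔ a ≤ b := max_eq_right_iff

instance : IsTotOrd (MaxPlus G) := ⟨fun a b => max_choice a b⟩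

/-- The element `t ^ a` of `MaxPlus G` that corresponds to `a : G`. -/
def t (a : G) : MaxPlus G := ((Multiplicative.ofAdd a : Multiplicative G) : WithZero _)

/-- The map `MaxPlus G → MaxPlus H` which extends `g : G → H` by `-∞ ↦ -∞`. -/
def map {G H : Type*} (g : G → H) : MaxPlus G → MaxPlus H :=
  fun x => WithZero.recZeroCoe (motive := fun _ => MaxPlus H) (0 : WithZero (Multiplicative H))
    (fun a => t (g a.toAdd)) x

theorem map_t {G H : Type*} (g : G → H) (a : G) : map g (t a) = t (g a) := rfl

theorem map_zero {G H : Type*} [AddCommGroup G] [LinearOrder G] [IsOrderedAddMonoid G]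
    [AddCommGroup H] [LinearOrder H] [IsOrderedAddMonoid H] (g : G → H) :
    map g (0 : MaxPlus G) = 0 := rfl

end MaxPlus

/-- The tropical semifield: `ℝ ∪ {-∞}` with maximum and addition. -/
abbrev Trop : Type := MaxPlus ℝ

/-- A subsemiring `S` of the tropical semifield is a sub-semifield. -/
def IsSubsemifield (S : Subsemiring Trop) : Prop := ∀ x ∈ S, x ≠ 0 → x⁻¹ ∈ S

instance (S : Subsemiring Trop) : IsTotOrd S :=
  ⟨fun a b => (IsTotOrd.add_eq_or (a : Trop) b).imp (fun h => Subtype.ext h)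
    (fun h => Subtype.ext h)⟩

/-! ### The canonical topology of a totally ordered semifield -/

/-- The canonical topology of a totally ordered semifield `K`, with the base of all sets `{a}` and
`[0, a]` for `a ≠ 0`. -/
@[reducible] def semifieldTopology (K : Type*) [CommSemiring K] : TopologicalSpace K :=
  TopologicalSpace.generateFrom {U | ∃ a : K, a ≠ 0 ∧ (U = {a} ∨ U = {b | CanonLE b a})}

/-- A set is open exactly if it does not contain `0` or it contains `[0, a]` for some `a ≠ 0`. -/
theorem isOpen_semifieldTopology_iff (K : Type*) [CommSemiring K] [IsTotOrd K] [Nontrivial K]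
    (U : Set K) :
    IsOpen[semifieldTopology K] U ↔ (0 ∈ U → ∃ a : K, a ≠ 0 ∧ {b | CanonLE b a} ⊆ U) := by
  constructor
  · intro h
    induction h with
    | basic s hs =>
      intro h0
      obtain ⟨a, ha, rfl | rfl⟩ := hs
      · exact absurd h0.symm ha
      · exact ⟨a, ha, subset_rfl⟩
    | univ => exact fun _ => ⟨1, one_ne_zero, Set.subset_univ _⟩
    | inter s t _ _ hs ht =>
      rintro ⟨h1, h2⟩
      obtain ⟨a, ha, hsa⟩ := hs h1
      obtain ⟨b, hb, htb⟩ := ht h2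
      rcases CanonLE.total a b with h | h
      · exact ⟨a, ha, fun x hx => ⟨hsa hx, htb (CanonLE.trans hx h)⟩⟩
      · exact ⟨b, hb, fun x hx => ⟨hsa (CanonLE.trans hx h), htb hx⟩⟩
    | sUnion T _ ih =>
      rintro ⟨s, hs, h0⟩
      obtain ⟨a, ha, hsa⟩ := ih s hs h0
      exact ⟨a, ha, hsa.trans (Set.subset_sUnion_of_mem hs)⟩
  · intro h
    let _ := semifieldTopology K
    rw [isOpen_iff_forall_mem_open]
    intro x hx
    by_cases hx0 : x = 0
    · subst hx0
      obtain ⟨a, ha, hU⟩ := h hx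
      exact ⟨_, hU, TopologicalSpace.GenerateOpen.basic _ ⟨a, ha, Or.inr rfl⟩,
        CanonLE.zero_le a⟩
    · exact ⟨{x}, by simpa using hx, TopologicalSpace.GenerateOpen.basic _ ⟨x, hx0, Or.inl rfl⟩,
        rfl⟩

/-! ### Prime congruences and residue semifields -/

/-- A congruence `P` on `A` is prime if it is proper and `A / P` is totally ordered and
cancellative. -/
structure IsPrimeCong {A : Type*} [CommSemiring A] (P : RingCon A) : Prop where
  ne_top : P ≠ ⊤
  isTotOrd : IsTotOrd P.Quotient
  cancel : ∀ a : P.Quotient, a ≠ 0 → ∀ b c : P.Quotient, a * b = a * c → b = c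

/-- `P` has trivial ideal-kernel. -/
def TrivialIdealKernel {A : Type*} [CommSemiring A] (P : RingCon A) : Prop :=
  ∀ a : A, P a 0 → a = 0

/-- The submonoid of all cancellative elements of a semiring (for `R ≠ 0`, these are nonzero). -/
def cancellatives (R : Type*) [CommSemiring R] : Submonoid R where
  carrier := {a | ∀ b c : R, a * b = a * c → b = c}
  one_mem' b c h := by simpa using h
  mul_mem' {x y} hx hy b c h := hy _ _ (hx _ _ (by simpa [mul_assoc] using h))

/-- The total semiring of fractions. -/
abbrev TotalFrac (R : Type*) [CommSemiring R] : Type _ := Localization (cancellatives R)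

/-- The residue semifield `κ(P)`. -/
abbrev Residue {A : Type*} [CommSemiring A] (P : RingCon A) : Type _ := TotalFrac P.Quotient

/-- The canonical homomorphism `A → A / P → κ(P)`, `a ↦ |a|_P`. -/
def absVal {A : Type*} [CommSemiring A] (P : RingCon A) : A →+* Residue P :=
  (algebraMap P.Quotient (Residue P)).comp P.mk'

section Residue

variable {A : Type*} [CommSemiring A] {P : RingCon A}

theorem IsPrimeCong.nontrivial (hP : IsPrimeCong P) : Nontrivial P.Quotient := by
  by_contra h
  rw [not_nontrivial_iff_subsingleton] at h
  apply hP.ne_top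
  rw [eq_top_iff]
  intro a b _
  exact (RingCon.eq P).1 (Subsingleton.elim _ _)

theorem IsPrimeCong.mem_cancellatives (hP : IsPrimeCong P) {a : P.Quotient} (ha : a ≠ 0) :
    a ∈ cancellatives P.Quotient := hP.cancel a ha

theorem toResidue_injective (P : RingCon A) :
    Function.Injective (algebraMap P.Quotient (Residue P)) := by
  intro a b h
  obtain ⟨c, hc⟩ := (IsLocalization.eq_iff_exists (cancellatives P.Quotient) _).1 h
  exact c.2 _ _ hc

theorem IsPrimeCong.isTotOrd_residue (hP : IsPrimeCong P) : IsTotOrd (Residue P) := by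
  have := hP.isTotOrd
  refine ⟨fun x y => ?_⟩
  obtain ⟨⟨a, b⟩, d, rfl, rfl⟩ :
      ∃ p : P.Quotient × P.Quotient, ∃ d : cancellatives P.Quotient,
        x = IsLocalization.mk' (Residue P) p.1 d ∧ y = IsLocalization.mk' (Residue P) p.2 d := by
    obtain ⟨a, s, rfl⟩ := IsLocalization.exists_mk'_eq (cancellatives P.Quotient) x
    obtain ⟨b, t, rfl⟩ := IsLocalization.exists_mk'_eq (cancellatives P.Quotient) y
    refine ⟨(a * t, b * s), s * t, ?_, ?_⟩
    · exact (IsLocalization.mk'_cancel a s t).symm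
    · rw [mul_comm s t]; exact (IsLocalization.mk'_cancel b t s).symm
  have h : IsLocalization.mk' (Residue P) a d + IsLocalization.mk' (Residue P) b d =
      IsLocalization.mk' (Residue P) (a + b) d := by
    rw [← IsLocalization.mk'_add, ← add_mul, IsLocalization.mk'_cancel]
  exact (IsTotOrd.add_eq_or a b).imp (fun e => by simp only [h, e]) (fun e => by simp only [h, e])

end Residue

/-! ### The universal topology and continuous spectra -/

/-- The finest topology on the semiring `A` which makes `A` a topological semiring and `ψ : X → A`
continuous (in the order on topologies used here, finer topologies are smaller). -/
@[reducible] def universalTopology {X A : Type*} (tX : TopologicalSpace X) [CommSemiring A]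
    (ψ : X → A) : TopologicalSpace A :=
  sInf {τ | @IsTopologicalSemiring A τ _ ∧ @Continuous X A tX τ ψ}

section Universal

variable {X A : Type*} (tX : TopologicalSpace X) [CommSemiring A] (ψ : X → A)

theorem universalTopology_isTopologicalSemiring :
    @IsTopologicalSemiring A (universalTopology tX ψ) _ := by
  let _ := universalTopology tX ψ
  have h1 : @ContinuousAdd A (universalTopology tX ψ) _ :=
    continuousAdd_sInf (fun τ hτ => hτ.1.toContinuousAdd)
  have h2 : @ContinuousMul A (universalTopology tX ψ) _ :=
    continuousMul_sInf (fun τ hτ => hτ.1.toContinuousMul)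
  exact @IsTopologicalSemiring.mk A (universalTopology tX ψ) _ h1 h2

theorem continuous_universalTopology : @Continuous X A tX (universalTopology tX ψ) ψ :=
  continuous_sInf_rng.2 (fun _ hτ => hτ.2)

/-- The universal property of the universal topology. -/
theorem continuous_universalTopology_iff {B : Type*} [CommSemiring B] [tB : TopologicalSpace B]
    [IsTopologicalSemiring B] (φ : A →+* B) :
    @Continuous A B (universalTopology tX ψ) tB φ ↔ @Continuous X B tX tB (φ ∘ ψ) := by
  constructor
  · intro h
    exact @Continuous.comp X A B tX (universalTopology tX ψ) tB ψ φ h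
      (continuous_universalTopology tX ψ)
  · intro h
    rw [continuous_iff_le_induced]
    refine sInf_le ⟨?_, ?_⟩
    · let _ : TopologicalSpace A := TopologicalSpace.induced φ tB
      have h1 : ContinuousAdd A := continuousAdd_induced φ
      have h2 : ContinuousMul A := continuousMul_induced φ
      exact { }
    · exact continuous_induced_rng.2 h

end Universal

/-- The continuous spectrum of the topological semiring `A`: the prime congruences `P` such that
`A / P` is not the Boolean semifield `{0, 1}` and `A → κ(P)` is continuous. -/
def ContSpec (A : Type*) [CommSemiring A] [tA : TopologicalSpace A] : Set (RingCon A) :=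
  {P | IsPrimeCong P ∧ (∃ x : P.Quotient, x ≠ 0 ∧ x ≠ 1) ∧
    @Continuous A (Residue P) tA (semifieldTopology (Residue P)) (absVal P)}

/-- `Cont_S A` for an algebra `A` over a totally ordered semifield `S`: the continuous spectrum of
`A` with the universal topology for `S → A`, where `S` has its canonical topology. -/
def ContOver (S A : Type*) [CommSemiring S] [CommSemiring A] [Algebra S A] : Set (RingCon A) :=
  @ContSpec A _ (universalTopology (semifieldTopology S) (algebraMap S A))

/-- `Cont°_S A`: the elements of `Cont_S A` with trivial ideal-kernel. -/
def ContOverInt (S A : Type*) [CommSemiring S] [CommSemiring A] [Algebra S A] :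
    Set (RingCon A) :=
  {P | P ∈ ContOver S A ∧ TrivialIdealKernel P}

/-- A consequence of continuity: the image of `S` has arbitrarily small nonzero elements. -/
theorem ContOver.exists_small {S A : Type*} [CommSemiring S] [IsTotOrd S] [CommSemiring A]
    [Algebra S A] {P : RingCon A} (hP : P ∈ ContOver S A) {b N : P.Quotient} (hb : b ≠ 0)
    (hN : N ≠ 0) :
    ∃ s : S, s ≠ 0 ∧ CanonLE (P.mk' (algebraMap S A s) * N) b := by
  obtain ⟨hprime, -, hcont⟩ := hP
  have := hprime.nontrivial
  have hSn : Nontrivial S := by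
    by_contra h
    rw [not_nontrivial_iff_subsingleton] at h
    have h01 : (0 : S) = 1 := Subsingleton.elim _ _
    have : (P.mk' (algebraMap S A 0)) = P.mk' (algebraMap S A 1) := by rw [h01]
    simp at this
  set N' : cancellatives P.Quotient := ⟨N, hprime.cancel N hN⟩
  set a : Residue P := IsLocalization.mk' (Residue P) b N' with ha
  have haN : a * algebraMap P.Quotient (Residue P) N = algebraMap _ _ b :=
    IsLocalization.mk'_spec (Residue P) b N'
  have ha0 : a ≠ 0 := by
    intro h
    rw [h, zero_mul] at haN
    exact hb (toResidue_injective P (by rw [← haN, _root_.map_zero]))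
  have hc := @Continuous.comp S A (Residue P) (semifieldTopology S)
    (universalTopology (semifieldTopology S) (algebraMap S A)) (semifieldTopology (Residue P)) _ _
    hcont (continuous_universalTopology _ _)
  have hopen := @Continuous.isOpen_preimage S (Residue P) (semifieldTopology S)
    (semifieldTopology (Residue P)) _ hc {x | CanonLE x a}
    (TopologicalSpace.GenerateOpen.basic _ ⟨a, ha0, Or.inr rfl⟩)
  obtain ⟨s, hs, hsub⟩ := (isOpen_semifieldTopology_iff S _).1 hopen (by
    simp [CanonLE])
  refine ⟨s, hs, ?_⟩
  have h1 : CanonLE (absVal P (algebraMap S A s)) a := hsub (CanonLE.refl s)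
  have h2 := h1.mul_right (algebraMap P.Quotient (Residue P) N)
  rw [haN] at h2
  apply toResidue_injective P
  rw [map_add, map_mul]
  exact h2

/-! ### Convergent power series -/

section Series

variable {S : Type v} [CommSemiring S] {M : Type u} [AddCommMonoid M]

/-- The series `∑ f_u χ^u`, given by its coefficients, converges at `P`: for every nonzero `b` in
`S[M] / P` there are only finitely many `u` with `|f_u χ^u|_P ≥ b`. -/
def Converges (P : RingCon (AddMonoidAlgebra S M)) (f : M → S) : Prop :=
  ∀ b : P.Quotient, b ≠ 0 →
    {u : M | CanonLE b (P.mk' (AddMonoidAlgebra.single u (f u)))}.Finite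

/-- The coefficient at `u` of the product of two series: the maximum of `f_v g_w` over all `v`, `w`
with `v + w = u`. -/
def mulCoeff (f g : M → S) (u : M) : S :=
  maxOf {x | ∃ v w : M, v + w = u ∧ x = f v * g w}

/-- The distance `d_P(f, g)`, the maximum of `|(f_u + g_u) χ^u|_P` over all `u` with
`f_u ≠ g_u`. -/
def cnvgDist (P : RingCon (AddMonoidAlgebra S M)) (f g : M → S) : Residue P :=
  maxOf {x | ∃ u : M, f u ≠ g u ∧ x = absVal P (AddMonoidAlgebra.single u (f u + g u))}

/-- `Cnvg P`, the set of power series that converge at `P`. -/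
def Cnvg (P : ContOverInt S (AddMonoidAlgebra S M)) : Type (max u v) :=
  {f : M → S // Converges P.1 f}

/-- A monoid is pseudo-cancellative if for all `u`, `w` there are only finitely many `v` with
`u = v + w`. -/
def PseudoCancellative (M : Type*) [AddCommMonoid M] : Prop :=
  ∀ u w : M, {v : M | u = v + w}.Finite

/-- `|s χ^u|_P` in `S[M] / P`. -/
def tm (P : RingCon (AddMonoidAlgebra S M)) (u : M) (s : S) : P.Quotient :=
  P.mk' (AddMonoidAlgebra.single u s)

theorem tm_mul (P : RingCon (AddMonoidAlgebra S M)) (u v : M) (s t : S) :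
    tm P (u + v) (s * t) = tm P u s * tm P v t := by
  simp only [tm, ← map_mul, AddMonoidAlgebra.single_mul_single]

theorem tm_add (P : RingCon (AddMonoidAlgebra S M)) (u : M) (s t : S) :
    tm P u (s + t) = tm P u s + tm P u t := by
  simp only [tm, ← map_add, AddMonoidAlgebra.single_add]

theorem tm_zero (P : RingCon (AddMonoidAlgebra S M)) (u : M) : tm P u (0 : S) = 0 := by
  simp [tm]

theorem tm_mono (P : RingCon (AddMonoidAlgebra S M)) (u : M) {s t : S} (h : CanonLE s t) :
    CanonLE (tm P u s) (tm P u t) := by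
  unfold CanonLE at *
  rw [← tm_add, h]

variable {P : RingCon (AddMonoidAlgebra S M)}

theorem tm_ne_zero (hP : TrivialIdealKernel P) {u : M} {s : S} (hs : s ≠ 0) : tm P u s ≠ 0 := by
  intro h
  have h' : P.mk' (AddMonoidAlgebra.single u s) = P.mk' 0 := by simpa [tm] using h
  have := hP _ ((RingCon.eq P).1 h')
  exact hs (by simpa using this)

theorem Converges.exists_bound (hP : IsPrimeCong P) {f : M → S} (hf : Converges P f) :
    ∃ N : P.Quotient, N ≠ 0 ∧ ∀ u, CanonLE (tm P u (f u)) N := by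
  have := hP.isTotOrd
  have := hP.nontrivial
  have hfin := hf 1 one_ne_zero
  by_cases hne : {u : M | CanonLE 1 (P.mk' (AddMonoidAlgebra.single u (f u)))}.Nonempty
  · obtain ⟨i, hi, hmax⟩ := exists_isMaxOf_of_finite (fun u => tm P u (f u)) hfin hne
    refine ⟨tm P i (f i), ?_, fun u => ?_⟩
    · intro h
      have hi' : CanonLE 1 (tm P i (f i)) := hi
      rw [h] at hi'
      exact one_ne_zero hi'.eq_zero
    · rcases CanonLE.total 1 (tm P u (f u)) with h | h
      · exact hmax u h
      · exact h.trans hi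
  · refine ⟨1, one_ne_zero, fun u => ?_⟩
    rcases CanonLE.total 1 (tm P u (f u)) with h | h
    · exact absurd ⟨u, h⟩ hne
    · exact h

theorem converges_coeff (P : RingCon (AddMonoidAlgebra S M)) (f : AddMonoidAlgebra S M) :
    Converges P (fun u => f.coeff u) := by
  intro b hb
  refine f.coeff.support.finite_toSet.subset ?_
  intro u (hu : CanonLE b (tm P u (f.coeff u)))
  simp only [Finset.mem_coe, Finsupp.mem_support_iff]
  intro h
  rw [h, tm_zero] at hu
  exact hb hu.eq_zero

variable [IsTotOrd S]

/-- For nonzero `b` and `N` there are only finitely many `u` with `|f_u χ^u|_P N ≥ b`. -/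
theorem Converges.finite_mul (hP : P ∈ ContOverInt S (AddMonoidAlgebra S M)) {f : M → S}
    (hf : Converges P f) {b N : P.Quotient} (hb : b ≠ 0) (hN : N ≠ 0) :
    {u : M | CanonLE b (tm P u (f u) * N)}.Finite := by
  have := hP.1.1.isTotOrd
  obtain ⟨s, hs, hsb⟩ := ContOver.exists_small hP.1 hb hN
  have hs0 : tm P 0 s ≠ 0 := tm_ne_zero hP.2 hs
  have hsb' : CanonLE (tm P 0 s * N) b := by
    simpa [tm] using hsb
  refine (hf _ hs0).subset fun u hu => ?_
  change CanonLE b (tm P u (f u) * N) at hu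
  change CanonLE (tm P 0 s) (tm P u (f u))
  rcases CanonLE.total (tm P 0 s) (tm P u (f u)) with h | h
  · exact h
  · have h4 := (h.mul_right N).antisymm (hsb'.trans hu)
    have h5 : N * tm P u (f u) = N * tm P 0 s := by rw [mul_comm N, mul_comm N, h4]
    rw [hP.1.1.cancel N hN _ _ h5]
    exact CanonLE.refl _

/-- For `b ≠ 0` there are only finitely many pairs with `|f_v χ^v|_P |g_w χ^w|_P ≥ b`. -/
theorem Converges.finite_pairs (hP : P ∈ ContOverInt S (AddMonoidAlgebra S M)) {f g : M → S}
    (hf : Converges P f) (hg : Converges P g) {b : P.Quotient} (hb : b ≠ 0) :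
    {p : M × M | CanonLE b (tm P p.1 (f p.1) * tm P p.2 (g p.2))}.Finite := by
  obtain ⟨N, hN, hfN⟩ := hf.exists_bound hP.1.1
  obtain ⟨N', hN', hgN⟩ := hg.exists_bound hP.1.1
  refine ((hf.finite_mul hP hb hN').prod (hg.finite_mul hP hb hN)).subset ?_
  rintro ⟨v, w⟩ (h : CanonLE b (tm P v (f v) * tm P w (g w)))
  refine ⟨h.trans ((hgN w).mul_left _), ?_⟩
  rw [mul_comm] at h
  exact h.trans ((hfN v).mul_left _)

/-- The maximum in the definition of the product exists. -/
theorem mulCoeff_spec (hP : P ∈ ContOverInt S (AddMonoidAlgebra S M)) {f g : M → S}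
    (hf : Converges P f) (hg : Converges P g) (u : M) :
    IsMaxOf {x | ∃ v w : M, v + w = u ∧ x = f v * g w} (mulCoeff f g u) := by
  apply maxOf_spec
  by_cases h0 : ∀ v w : M, v + w = u → f v * g w = 0
  · refine ⟨0, ⟨0, u, zero_add u, (h0 0 u (zero_add u)).symm⟩, ?_⟩
    rintro _ ⟨v, w, hvw, rfl⟩
    rw [h0 v w hvw]
    exact CanonLE.refl 0
  · push Not at h0
    obtain ⟨v₀, w₀, h, hne⟩ := h0
    have hfin : {p : M × M | p.1 + p.2 = u ∧ CanonLE (f v₀ * g w₀) (f p.1 * g p.2)}.Finite := by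
      refine (hf.finite_pairs hP hg (tm_ne_zero hP.2 (u := u) hne)).subset ?_
      rintro ⟨v, w⟩ ⟨hvw, hle⟩
      have := tm_mono P u hle
      change CanonLE _ (tm P v (f v) * tm P w (g w))
      rw [← tm_mul]
      change v + w = u at hvw
      rw [hvw]
      exact this
    obtain ⟨p, hp, hmax⟩ := exists_isMaxOf_of_finite (fun p : M × M => f p.1 * g p.2) hfin
      ⟨(v₀, w₀), h, CanonLE.refl _⟩
    refine ⟨_, ⟨p.1, p.2, hp.1, rfl⟩, ?_⟩
    rintro _ ⟨v, w, hvw, rfl⟩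
    rcases CanonLE.total (f v₀ * g w₀) (f v * g w) with hle | hle
    · exact hmax (v, w) ⟨hvw, hle⟩
    · exact hle.trans hp.2

theorem mulCoeff_mul_le_iff (hP : P ∈ ContOverInt S (AddMonoidAlgebra S M)) {f g : M → S}
    (hf : Converges P f) (hg : Converges P g) (u : M) (c z : S) :
    CanonLE (mulCoeff f g u * c) z ↔ ∀ v w, v + w = u → CanonLE (f v * g w * c) z := by
  obtain ⟨⟨v₀, w₀, h, he⟩, hmax⟩ := mulCoeff_spec hP hf hg u
  constructor
  · intro hle v w hvw
    exact ((hmax _ ⟨v, w, hvw, rfl⟩).mul_right c).trans hle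
  · intro hall
    rw [he]
    exact hall v₀ w₀ h

theorem mulCoeff_le_iff (hP : P ∈ ContOverInt S (AddMonoidAlgebra S M)) {f g : M → S}
    (hf : Converges P f) (hg : Converges P g) (u : M) (z : S) :
    CanonLE (mulCoeff f g u) z ↔ ∀ v w, v + w = u → CanonLE (f v * g w) z := by
  simpa using mulCoeff_mul_le_iff hP hf hg u 1 z

theorem Converges.mul (hP : P ∈ ContOverInt S (AddMonoidAlgebra S M)) {f g : M → S}
    (hf : Converges P f) (hg : Converges P g) : Converges P (mulCoeff f g) := by
  intro b hb
  refine ((hf.finite_pairs hP hg hb).image (fun p => p.1 + p.2)).subset ?_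
  intro u (hu : CanonLE b (tm P u (mulCoeff f g u)))
  obtain ⟨⟨v, w, rfl, he⟩, -⟩ := mulCoeff_spec hP hf hg u
  rw [he, tm_mul] at hu
  exact ⟨(v, w), hu, rfl⟩

theorem Converges.add {f g : M → S} (hf : Converges P f) (hg : Converges P g) :
    Converges P (f + g) := by
  intro b hb
  refine ((hf b hb).union (hg b hb)).subset ?_
  intro u (hu : CanonLE b (tm P u (f u + g u)))
  rcases IsTotOrd.add_eq_or (f u) (g u) with h | h
  · rw [h] at hu; exact Or.inl hu
  · rw [h] at hu; exact Or.inr hu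

end Series

/-! ### The topological semiring of convergent power series -/

namespace Cnvg

variable {S : Type v} [CommSemiring S] {M : Type u} [AddCommMonoid M]
  {P : ContOverInt S (AddMonoidAlgebra S M)}

/-- The coefficient of `χ^u`. -/
def coeff (f : Cnvg P) (u : M) : S := f.1 u

theorem ext {f g : Cnvg P} (h : ∀ u, f.coeff u = g.coeff u) : f = g := Subtype.ext (funext h)

instance : Zero (Cnvg P) := ⟨⟨_, converges_coeff P.1 0⟩⟩

instance : One (Cnvg P) := ⟨⟨_, converges_coeff P.1 1⟩⟩

theorem coeff_zero (u : M) : (0 : Cnvg P).coeff u = 0 := rfl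

theorem coeff_one (u : M) : (1 : Cnvg P).coeff u = (1 : AddMonoidAlgebra S M).coeff u := rfl

variable [IsTotOrd S]

instance : Add (Cnvg P) := ⟨fun f g => ⟨_, f.2.add g.2⟩⟩

instance : Mul (Cnvg P) := ⟨fun f g => ⟨_, f.2.mul P.2 g.2⟩⟩

theorem coeff_add (f g : Cnvg P) (u : M) : (f + g).coeff u = f.coeff u + g.coeff u := rfl

theorem coeff_mul (f g : Cnvg P) (u : M) : (f * g).coeff u = mulCoeff f.coeff g.coeff u := rfl

theorem coeff_mul_le_iff (f g : Cnvg P) (u : M) (z : S) :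
    CanonLE ((f * g).coeff u) z ↔ ∀ v w, v + w = u → CanonLE (f.coeff v * g.coeff w) z :=
  mulCoeff_le_iff P.2 f.2 g.2 u z

theorem coeff_mul_mul_le_iff (f g : Cnvg P) (u : M) (c z : S) :
    CanonLE ((f * g).coeff u * c) z ↔ ∀ v w, v + w = u → CanonLE (f.coeff v * g.coeff w * c) z :=
  mulCoeff_mul_le_iff P.2 f.2 g.2 u c z

protected theorem mul_comm (f g : Cnvg P) : f * g = g * f := by
  refine ext fun u => eq_of_forall_canonLE_iff fun z => ?_
  rw [coeff_mul_le_iff, coeff_mul_le_iff]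
  constructor <;> intro h v w hvw <;> rw [mul_comm] <;> exact h w v (by rw [add_comm, hvw])

protected theorem mul_assoc_le (f g h : Cnvg P) (u : M) (z : S) :
    CanonLE ((f * g * h).coeff u) z ↔
      ∀ a b c, a + b + c = u → CanonLE (f.coeff a * g.coeff b * h.coeff c) z := by
  rw [coeff_mul_le_iff]
  constructor
  · intro H a b c habc
    exact (coeff_mul_mul_le_iff f g _ _ _).1 (H (a + b) c habc) a b rfl
  · intro H d c hdc
    rw [coeff_mul_mul_le_iff]
    rintro a b rfl
    exact H a b c hdc

protected theorem mul_assoc (f g h : Cnvg P) : f * g * h = f * (g * h) := by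
  refine ext fun u => eq_of_forall_canonLE_iff fun z => ?_
  rw [Cnvg.mul_comm f (g * h), Cnvg.mul_assoc_le, Cnvg.mul_assoc_le]
  constructor
  · intro H a b c habc
    have := H c a b (by rw [← habc]; abel)
    rwa [mul_rotate] at this
  · intro H a b c habc
    have := H b c a (by rw [← habc]; abel)
    rwa [← mul_rotate] at this

protected theorem one_mul (f : Cnvg P) : 1 * f = f := by
  classical
  refine ext fun u => eq_of_forall_canonLE_iff fun z => ?_
  rw [coeff_mul_le_iff]
  constructor
  · intro H
    have := H 0 u (zero_add u)
    simpa [coeff_one, AddMonoidAlgebra.one_def] using this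
  · intro H v w hvw
    by_cases hv : v = 0
    · subst hv
      rw [zero_add] at hvw
      subst hvw
      simpa [coeff_one, AddMonoidAlgebra.one_def] using H
    · have : (1 : Cnvg P).coeff v = 0 := by
        simp [coeff_one, AddMonoidAlgebra.one_def, hv]
      rw [this, zero_mul]
      exact CanonLE.zero_le z

protected theorem zero_mul (f : Cnvg P) : 0 * f = 0 := by
  refine ext fun u => eq_of_forall_canonLE_iff fun z => ?_
  rw [coeff_mul_le_iff]
  simp [coeff_zero, CanonLE]

protected theorem add_mul (f g h : Cnvg P) : (f + g) * h = f * h + g * h := by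
  refine ext fun u => eq_of_forall_canonLE_iff fun z => ?_
  rw [coeff_add, canonLE_add_iff, coeff_mul_le_iff, coeff_mul_le_iff, coeff_mul_le_iff]
  simp only [coeff_add, add_mul, canonLE_add_iff]
  exact ⟨fun H => ⟨fun v w hvw => (H v w hvw).1, fun v w hvw => (H v w hvw).2⟩,
    fun H v w hvw => ⟨H.1 v w hvw, H.2 v w hvw⟩⟩

/-- The semiring of convergent power series: addition is coefficientwise, multiplication is given
by `mulCoeff`. -/
instance : CommSemiring (Cnvg P) where
  add_assoc f g h := ext fun u => add_assoc _ _ _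
  zero_add f := ext fun u => zero_add _
  add_zero f := ext fun u => add_zero _
  add_comm f g := ext fun u => add_comm _ _
  nsmul := nsmulRec
  mul_assoc := Cnvg.mul_assoc
  mul_comm := Cnvg.mul_comm
  one_mul := Cnvg.one_mul
  mul_one f := by rw [Cnvg.mul_comm, Cnvg.one_mul]
  zero_mul := Cnvg.zero_mul
  mul_zero f := by rw [Cnvg.mul_comm, Cnvg.zero_mul]
  right_distrib := Cnvg.add_mul
  left_distrib f g h := by
    rw [Cnvg.mul_comm, Cnvg.add_mul, Cnvg.mul_comm g, Cnvg.mul_comm h]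

/-- The open ball around `f` of radius `r`. -/
def ball (f : Cnvg P) (r : Residue P.1) : Set (Cnvg P) :=
  {g | CanonLT (cnvgDist P.1 g.coeff f.coeff) r}

/-- The distance is attained: the maximum in its definition exists for `f ≠ g`. -/
theorem dist_spec {f g : Cnvg P} (h : f ≠ g) :
    IsMaxOf {x | ∃ u : M, f.coeff u ≠ g.coeff u ∧
      x = absVal P.1 (AddMonoidAlgebra.single u (f.coeff u + g.coeff u))}
      (cnvgDist P.1 f.coeff g.coeff) := by
  apply maxOf_spec
  have := P.2.1.1.isTotOrd
  have hne : ∃ u, f.coeff u ≠ g.coeff u := by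
    by_contra hc
    push Not at hc
    exact h (ext hc)
  obtain ⟨u₀, hu₀⟩ := hne
  let F : M → P.1.Quotient := fun u => tm P.1 u (f.coeff u + g.coeff u)
  have key : ∃ u, f.coeff u ≠ g.coeff u ∧ ∀ v, f.coeff v ≠ g.coeff v → CanonLE (F v) (F u) := by
    by_cases h0 : F u₀ = 0
    · have hs : f.coeff u₀ + g.coeff u₀ = 0 := by
        by_contra hc
        exact tm_ne_zero P.2.2 hc h0
      have h1 : f.coeff u₀ = 0 := (hs ▸ CanonLE.le_add_left (f.coeff u₀) (g.coeff u₀)).eq_zero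
      have h2 : g.coeff u₀ = 0 := (hs ▸ CanonLE.le_add_right (f.coeff u₀) (g.coeff u₀)).eq_zero
      exact absurd (h1.trans h2.symm) hu₀
    · have hfin : {u | f.coeff u ≠ g.coeff u ∧ CanonLE (F u₀) (F u)}.Finite :=
        (f.2.add g.2 _ h0).subset fun u hu => hu.2
      obtain ⟨u, hu, hmax⟩ := exists_isMaxOf_of_finite F hfin ⟨u₀, hu₀, CanonLE.refl _⟩
      refine ⟨u, hu.1, fun v hv => ?_⟩
      rcases CanonLE.total (F u₀) (F v) with hle | hle
      · exact hmax v ⟨hv, hle⟩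
      · exact hle.trans hu.2
  obtain ⟨u, hu, hmax⟩ := key
  refine ⟨_, ⟨u, hu, rfl⟩, ?_⟩
  rintro _ ⟨v, hv, rfl⟩
  exact (hmax v hv).map (algebraMap P.1.Quotient (Residue P.1))

/-- The topology of the metric `cnvgDist`: a set is open if it contains with each of its points `f` an
open ball around `f`, of some radius `r ≠ 0` in `κ(P)`. -/
instance : TopologicalSpace (Cnvg P) where
  IsOpen U := ∀ f ∈ U, ∃ r : Residue P.1, r ≠ 0 ∧ ball f r ⊆ U
  isOpen_univ f _ := by
    have := P.2.1.1.nontrivial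
    refine ⟨1, fun h => ?_, Set.subset_univ _⟩
    apply one_ne_zero (α := P.1.Quotient)
    apply toResidue_injective P.1
    rw [map_one, h, _root_.map_zero]
  isOpen_inter U V hU hV f hf := by
    have := P.2.1.1.isTotOrd_residue
    obtain ⟨r, hr, hrU⟩ := hU f hf.1
    obtain ⟨r', hr', hrV⟩ := hV f hf.2
    rcases CanonLE.total r r' with h | h
    · refine ⟨r, hr, fun g hg => ⟨hrU hg, hrV ⟨hg.1.trans h, fun he => ?_⟩⟩⟩
      exact hg.2 (hg.1.antisymm (he ▸ h))
    · refine ⟨r', hr', fun g hg => ⟨hrU ⟨hg.1.trans h, fun he => ?_⟩, hrV hg⟩⟩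
      exact hg.2 (hg.1.antisymm (he ▸ h))
  isOpen_sUnion T hT f hf := by
    obtain ⟨U, hU, hfU⟩ := hf
    obtain ⟨r, hr, h⟩ := hT U hU f hfU
    exact ⟨r, hr, h.trans (Set.subset_sUnion_of_mem hU)⟩

variable (P) in
/-- The inclusion on additive monoids of polynomials into convergent power series. -/
def inclAdd : AddMonoidAlgebra S M →+ Cnvg P where
  toFun f := ⟨_, converges_coeff P.1 f⟩
  map_zero' := rfl
  map_add' _ _ := rfl

theorem coeff_inclAdd (f : AddMonoidAlgebra S M) (u : M) : (inclAdd P f).coeff u = f.coeff u := rfl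

theorem inclAdd_mul (f g : AddMonoidAlgebra S M) :
    inclAdd P (f * g) = inclAdd P f * inclAdd P g := by
  classical
  induction f using AddMonoidAlgebra.induction_linear with
  | zero => simp
  | add f f' hf hf' => simp only [add_mul, map_add, hf, hf']
  | single u a =>
    induction g using AddMonoidAlgebra.induction_linear with
    | zero => simp
    | add g g' hg hg' => simp only [mul_add, map_add, hg, hg']
    | single v b =>
      refine ext fun x => eq_of_forall_canonLE_iff fun z => ?_
      rw [AddMonoidAlgebra.single_mul_single, coeff_mul_le_iff]
      simp only [coeff_inclAdd, AddMonoidAlgebra.coeff_single, Finsupp.single_apply]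
      constructor
      · intro H y w hyw
        split_ifs with h1 h2
        · subst h1 h2
          simpa [hyw] using H
        all_goals simp [CanonLE.zero_le]
      · intro H
        split_ifs with h
        · simpa using H u v h
        · exact CanonLE.zero_le z

variable (P) in
/-- The inclusion `ι : S[M] → Cnvg P`, which takes a polynomial to its coefficients. -/
def incl : AddMonoidAlgebra S M →+* Cnvg P where
  __ := inclAdd P
  map_one' := rfl
  map_mul' := inclAdd_mul

theorem coeff_incl (f : AddMonoidAlgebra S M) (u : M) : (incl P f).coeff u = f.coeff u := rfl

end Cnvg

/-! ### Comparison of values at two primes -/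

/-- For a totally ordered set `I`, the totally ordered semifield of `ℝ^(I)`, the group of all
functions `I → ℝ` with well-ordered support, ordered lexicographically. -/
abbrev RLex (I : Type u) [LinearOrder I] : Type u := MaxPlus (Lex (HahnSeries I ℝ))

/-- The homomorphism `j : 𝕋 → RLex I`, the inclusion of the factor of the least element of `I`. -/
def jMap (I : Type u) [LinearOrder I] [OrderBot I] : Trop → RLex I :=
  MaxPlus.map (fun a : ℝ => toLex (HahnSeries.single (⊥ : I) a))

/-- A joint Hahn embedding of `κ(P)` and `κ(P')` over `S ⊆ 𝕋`: a totally ordered set `I` with a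
least element and embeddings of both residue semifields into `RLex I` such that the compositions
with `S → κ(P)` and `S → κ(P')` are both the restriction of `j : 𝕋 → RLex I` to `S`. -/
structure JointHahnEmbedding (S : Subsemiring Trop) {M : Type u} [AddCommMonoid M]
    (P P' : RingCon (AddMonoidAlgebra S M)) where
  I : Type u
  [linearOrder : LinearOrder I]
  [orderBot : OrderBot I]
  φ : Residue P →+* RLex I
  φ' : Residue P' →+* RLex I
  φ_injective : Function.Injective φ
  φ'_injective : Function.Injective φ'
  φ_algebraMap (s : S) : φ (absVal P (algebraMap S (AddMonoidAlgebra S M) s)) = jMap I s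
  φ'_algebraMap (s : S) : φ' (absVal P' (algebraMap S (AddMonoidAlgebra S M) s)) = jMap I s

attribute [instance] JointHahnEmbedding.linearOrder JointHahnEmbedding.orderBot

/-- The condition (★) on `P'` with respect to `P`: for some nonzero `c ∈ S`, every term `m = a χ^u`
satisfies `c |m|_P ≥ |m|_{P'}`, where values are compared by means of the joint Hahn
embedding `E`. -/
def JointHahnEmbedding.Star {S : Subsemiring Trop} {M : Type u} [AddCommMonoid M]
    {P P' : RingCon (AddMonoidAlgebra S M)} (E : JointHahnEmbedding S P P') : Prop :=
  ∃ c : S, c ≠ 0 ∧ ∀ (u : M) (a : S),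
    E.φ' (absVal P' (AddMonoidAlgebra.single u a)) ≤
      jMap E.I c * E.φ (absVal P (AddMonoidAlgebra.single u a))

end TropCont

end

/-!
All values of series are maxima of values of terms, and every comparison needed is a comparison
with elements of `S`, whose values are coinitial and cofinal at any continuous prime. Therefore
`(★)` can be restated without a common value group (`TermBound`): for some `c ≠ 0` in `S`, a
term whose value at `P` is at most that of `s ∈ S` has at `P'` at most the value of `c s`. The
two forms are equivalent for each joint Hahn embedding (`JointHahnEmbedding.star_iff`): values
at `P` lie, up to a fixed factor `d > 1` of `S`, next to values of `S`, because `S` is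
Archimedean.

*The image.* If `Q` is a continuous prime of `Cnvg P`, some ball around `0`, of radius `|e|_P`
with `e ∈ S`, is mapped to values less than `1`. Rescaling terms by elements of `S` turns this
into `TermBound` for the pullback of `Q` (`Cnvg.termBound_comap_incl`). Conversely, `TermBound`
makes every series that converges at `P` converge at `P'` (`Converges.of_termBound`), so that
`f ↦ max |f_u χ^u|_{P'}` is a homomorphism `Cnvg P → S[M] / P'` (`Cnvg.extHom`). Its kernel is
prime and pulls back to `P'`; it is continuous since, by `TermBound`, series that are close at
`P` have coefficients that differ only in terms which are small at `P'`
(`Cnvg.ker_extHom_mem_contSpec`).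

*Injectivity.* At a continuous prime, the tail of a series is eventually smaller than the
series, so that a series is congruent to all its sufficiently long truncations
(`Cnvg.exists_trunc`); the prime is thus determined by its restriction to polynomials.

*Joint Hahn embeddings.* The group of units of `κ(P)` has a Hahn embedding by Mathlib's Hahn
embedding theorem. Since `S` is cofinal, its nonzero elements other than `1` lie in the largest
Archimedean class; the coefficient at this class, suitably scaled, is a monotone homomorphism to
`ℝ` that restricts to the identity on `S` (`AddSubgroup.map_mul_eq_of_nonneg`). The other
coefficients of the elements of `S` are removed by a shear, which exists as rational vector
spaces are injective (`exists_hahn_splitting`). The sets of exponents of `κ(P)` and `κ(P')` are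
finally placed side by side above a common least element.
-/

noncomputable section

namespace TropCont

open scoped Topology

universe u v

/-! ### Totally ordered cancellative semirings -/

section Order

variable {R : Type*} [CommSemiring R]

theorem CanonLE.of_eq [IsTotOrd R] {a b : R} (h : a = b) : CanonLE a b := h ▸ CanonLE.refl a

theorem CanonLE.of_not [IsTotOrd R] {a b : R} (h : ¬ CanonLE a b) : CanonLE b a :=
  (CanonLE.total a b).resolve_left h

theorem CanonLE.trans_lt {a b c : R} (h : CanonLE a b) (h' : CanonLT b c) : CanonLT a c :=
  ⟨h.trans h'.1, fun e => h'.2 (h'.1.antisymm (e ▸ h))⟩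

theorem CanonLT.not_le {a b : R} (h : CanonLT a b) : ¬ CanonLE b a := fun h' =>
  h.2 (h.1.antisymm h')

theorem canonLE_mul_cancel [IsTotOrd R] {a b c : R} (hc : ∀ x y : R, c * x = c * y → x = y)
    (h : CanonLE (a * c) (b * c)) : CanonLE a b := by
  rcases CanonLE.total a b with h' | h'
  · exact h'
  · refine CanonLE.of_eq (hc _ _ ?_)
    rw [mul_comm c, mul_comm c]
    exact h.antisymm (h'.mul_right c)

/-- If `R` has an element other than `0` and `1`, a strict bound on `y * N` follows from a suitable
weak bound on some `y * N'`. -/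
theorem exists_canonLE_imp_canonLT [IsTotOrd R]
    (hR : ∀ a : R, a ≠ 0 → ∀ b c : R, a * b = a * c → b = c) (hne : ∃ x : R, x ≠ 0 ∧ x ≠ 1)
    {b N : R} (hb : b ≠ 0) (hN : N ≠ 0) :
    ∃ b' N' : R, b' ≠ 0 ∧ N' ≠ 0 ∧ ∀ y, CanonLE (y * N') b' → CanonLT (y * N) b := by
  obtain ⟨x, hx0, hx1⟩ := hne
  have hmul : ∀ {a : R}, a ≠ 0 → x * a ≠ 0 := fun {a} ha h =>
    ha (hR x hx0 _ _ (h.trans (mul_zero x).symm))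
  -- For `x < 1` shrink the bound to `x b`, for `x > 1` enlarge the factor to `x N`.
  rcases CanonLE.total x 1 with h | h
  · refine ⟨x * b, N, hmul hb, hN, fun y hy => hy.trans_lt ⟨?_, fun e => hx1 ?_⟩⟩
    · simpa using h.mul_right b
    · refine hR b hb _ _ ?_
      rw [mul_comm b x, e, mul_one]
  · refine ⟨b, x * N, hb, hmul hN, fun y hy => ?_⟩
    have h1 : CanonLE (y * N) (y * (x * N)) := by simpa using (h.mul_right N).mul_left y
    refine ⟨h1.trans hy, fun e => hx1 ?_⟩
    have hyN : y * N ≠ 0 := e ▸ hb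
    refine hR _ hyN _ _ ?_
    rw [mul_one, mul_right_comm, mul_assoc]
    exact (h1.antisymm (hy.trans (CanonLE.of_eq e.symm))).symm

end Order

/-! ### Prime congruences as kernels -/

section Kernel

variable {A B : Type*} [CommSemiring A] [CommSemiring B] {Q : RingCon A} {ψ : A →+* B}

theorem canonLE_mk_iff (hQ : ∀ x y, Q x y ↔ ψ x = ψ y) (x y : A) :
    CanonLE (Q.mk' x) (Q.mk' y) ↔ CanonLE (ψ x) (ψ y) := by
  unfold CanonLE
  rw [← map_add, ← map_add, ← hQ]
  exact RingCon.eq Q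

theorem mk_eq_zero_iff (hQ : ∀ x y, Q x y ↔ ψ x = ψ y) (x : A) : Q.mk' x = 0 ↔ ψ x = 0 := by
  rw [← map_zero Q.mk', ← map_zero ψ, ← hQ]
  exact RingCon.eq Q

theorem mk_eq_one_iff (hQ : ∀ x y, Q x y ↔ ψ x = ψ y) (x : A) : Q.mk' x = 1 ↔ ψ x = 1 := by
  rw [← map_one Q.mk', ← map_one ψ, ← hQ]
  exact RingCon.eq Q

/-- The kernel of a homomorphism to a totally ordered cancellative semiring is prime. -/
theorem isPrimeCong_of_hom [Nontrivial B] [IsTotOrd B]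
    (hB : ∀ a : B, a ≠ 0 → ∀ b c : B, a * b = a * c → b = c)
    (hQ : ∀ x y, Q x y ↔ ψ x = ψ y) : IsPrimeCong Q where
  ne_top h := by
    have : Q 0 1 := h ▸ trivial
    rw [hQ, map_zero, map_one] at this
    exact zero_ne_one this
  isTotOrd := by
    refine ⟨fun a b => ?_⟩
    obtain ⟨a, rfl⟩ := Q.mk'_surjective a
    obtain ⟨b, rfl⟩ := Q.mk'_surjective b
    rw [← map_add]
    refine (IsTotOrd.add_eq_or (ψ a) (ψ b)).imp (fun h => ?_) (fun h => ?_) <;>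
    · rw [← map_add, ← hQ] at h
      exact (RingCon.eq Q).2 h
  cancel a ha b c h := by
    obtain ⟨a, rfl⟩ := Q.mk'_surjective a
    obtain ⟨b, rfl⟩ := Q.mk'_surjective b
    obtain ⟨c, rfl⟩ := Q.mk'_surjective c
    rw [Ne, mk_eq_zero_iff hQ] at ha
    rw [← map_mul, ← map_mul] at h
    have h' := (hQ _ _).1 ((RingCon.eq Q).1 h)
    rw [map_mul, map_mul] at h'
    exact (RingCon.eq Q).2 ((hQ _ _).2 (hB _ ha _ _ h'))

end Kernel

/-! ### Residue semifields and their topology -/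

section Residue

variable {A : Type*} [CommSemiring A] {P : RingCon A}

theorem IsPrimeCong.nontrivial_residue (hP : IsPrimeCong P) : Nontrivial (Residue P) :=
  have := hP.nontrivial
  (toResidue_injective P).nontrivial

/-- Every nonzero element of `κ(P)` is a fraction of nonzero elements of `A / P`. -/
theorem IsPrimeCong.exists_frac (hP : IsPrimeCong P) {x : Residue P} (hx : x ≠ 0) :
    ∃ b N : P.Quotient, b ≠ 0 ∧ N ≠ 0 ∧
      x * algebraMap _ (Residue P) N = algebraMap _ (Residue P) b := by
  have := hP.nontrivial
  obtain ⟨a, s, rfl⟩ := IsLocalization.exists_mk'_eq (cancellatives P.Quotient) x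
  refine ⟨a, s, fun h => hx (by simp [h]), fun h => ?_, IsLocalization.mk'_spec _ _ _⟩
  exact zero_ne_one (s.2 0 1 (by rw [h, zero_mul, zero_mul]))

theorem IsPrimeCong.isUnit_algebraMap (hP : IsPrimeCong P) {a : P.Quotient} (ha : a ≠ 0) :
    IsUnit (algebraMap _ (Residue P) a) :=
  IsLocalization.map_units (Residue P) (⟨a, hP.mem_cancellatives ha⟩ : cancellatives P.Quotient)

theorem IsPrimeCong.isUnit_residue (hP : IsPrimeCong P) {x : Residue P} (hx : x ≠ 0) :
    IsUnit x := by
  obtain ⟨b, N, hb, -, h⟩ := hP.exists_frac hx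
  exact isUnit_of_mul_isUnit_left (h ▸ hP.isUnit_algebraMap hb)

theorem canonLE_algebraMap_residue_iff {a b : P.Quotient} :
    CanonLE (algebraMap _ (Residue P) a) (algebraMap _ (Residue P) b) ↔ CanonLE a b := by
  unfold CanonLE
  rw [← map_add, (toResidue_injective P).eq_iff]

/-- Comparison with a fraction, cleared of its denominator. -/
theorem IsPrimeCong.canonLE_frac_iff (hP : IsPrimeCong P) {x : Residue P} {a b N : P.Quotient}
    (hN : N ≠ 0) (h : x * algebraMap _ (Residue P) N = algebraMap _ (Residue P) b) :
    CanonLE (algebraMap _ (Residue P) a) x ↔ CanonLE (a * N) b := by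
  have := hP.isTotOrd_residue
  rw [← canonLE_algebraMap_residue_iff, map_mul, ← h]
  refine ⟨fun h => h.mul_right _, canonLE_mul_cancel fun x y e => ?_⟩
  exact (hP.isUnit_algebraMap hN).mul_left_cancel e

theorem IsPrimeCong.eq_frac_iff (hP : IsPrimeCong P) {x : Residue P} {a b N : P.Quotient}
    (hN : N ≠ 0) (h : x * algebraMap _ (Residue P) N = algebraMap _ (Residue P) b) :
    algebraMap _ (Residue P) a = x ↔ a * N = b := by
  rw [← (toResidue_injective P).eq_iff, map_mul, ← h]
  exact ((hP.isUnit_algebraMap hN).mul_left_inj).symm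

end Residue

section Semifield

variable {K : Type*} [CommSemiring K]

theorem isOpen_singleton_semifieldTopology {a : K} (ha : a ≠ 0) :
    IsOpen[semifieldTopology K] {a} :=
  TopologicalSpace.GenerateOpen.basic _ ⟨a, ha, Or.inl rfl⟩

theorem isOpen_canonLE_semifieldTopology {a : K} (ha : a ≠ 0) :
    IsOpen[semifieldTopology K] {b | CanonLE b a} :=
  TopologicalSpace.GenerateOpen.basic _ ⟨a, ha, Or.inr rfl⟩

variable [IsTotOrd K] [Nontrivial K]

theorem isTopologicalSemiring_semifieldTopology (hK : ∀ x : K, x ≠ 0 → IsUnit x) :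
    @IsTopologicalSemiring K (semifieldTopology K) _ := by
  let _ := semifieldTopology K
  have hadd : ContinuousAdd K := by
    refine ⟨continuous_def.2 fun U hU => isOpen_prod_iff.2 fun x y hxy => ?_⟩
    have hU' := (isOpen_semifieldTopology_iff K U).1 hU
    change x + y ∈ U at hxy
    by_cases hx : x = 0
    · by_cases hy : y = 0
      · subst hx hy
        obtain ⟨a, ha, haU⟩ := hU' (by simpa using hxy)
        refine ⟨_, _, isOpen_canonLE_semifieldTopology ha, isOpen_canonLE_semifieldTopology ha,
          CanonLE.zero_le a, CanonLE.zero_le a, fun p hp => haU ?_⟩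
        exact canonLE_add_iff.2 hp
      · refine ⟨_, _, isOpen_canonLE_semifieldTopology hy, isOpen_singleton_semifieldTopology hy,
          hx ▸ CanonLE.zero_le y, rfl, ?_⟩
        rintro ⟨p, q⟩ ⟨hp, rfl⟩
        change p + q ∈ U
        rw [show p + q = q from hp]
        simpa [hx] using hxy
    · by_cases hy : y = 0
      · refine ⟨_, _, isOpen_singleton_semifieldTopology hx, isOpen_canonLE_semifieldTopology hx,
          rfl, hy ▸ CanonLE.zero_le x, ?_⟩
        rintro ⟨p, q⟩ ⟨rfl, hq⟩
        change p + q ∈ U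
        rw [add_comm, show q + p = p from hq]
        simpa [hy] using hxy
      · refine ⟨_, _, isOpen_singleton_semifieldTopology hx, isOpen_singleton_semifieldTopology hy,
          rfl, rfl, ?_⟩
        rintro ⟨p, q⟩ ⟨rfl, rfl⟩
        exact hxy
  have hmul : ContinuousMul K := by
    refine ⟨continuous_def.2 fun U hU => isOpen_prod_iff.2 fun x y hxy => ?_⟩
    have hU' := (isOpen_semifieldTopology_iff K U).1 hU
    change x * y ∈ U at hxy
    have key : ∀ x : K, x ≠ 0 → 0 ∈ U →
        ∃ b, b ≠ 0 ∧ ∀ q, CanonLE q b → x * q ∈ U := by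
      intro x hx h0
      obtain ⟨a, ha, haU⟩ := hU' h0
      obtain ⟨z, hz⟩ := (hK x hx).exists_right_inv
      refine ⟨z * a, fun h => ha ?_, fun q hq => haU ?_⟩
      · rw [← one_mul a, ← hz, mul_assoc, h, mul_zero]
      · have := hq.mul_left x
        rwa [← mul_assoc, hz, one_mul] at this
    by_cases hx : x = 0
    · have h0 : 0 ∈ U := by simpa [hx] using hxy
      by_cases hy : y = 0
      · subst hx hy
        obtain ⟨b, hb, h⟩ := key 1 one_ne_zero h0
        refine ⟨_, _, isOpen_canonLE_semifieldTopology hb,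
          isOpen_canonLE_semifieldTopology one_ne_zero, CanonLE.zero_le b, CanonLE.zero_le 1, ?_⟩
        rintro ⟨p, q⟩ ⟨hp, hq⟩
        have := h (p * q) (by simpa using (CanonLE.mul_left hq p).trans (by simpa using hp))
        simpa using this
      · obtain ⟨b, hb, h⟩ := key y hy h0
        refine ⟨_, _, isOpen_canonLE_semifieldTopology hb, isOpen_singleton_semifieldTopology hy,
          hx ▸ CanonLE.zero_le b, rfl, ?_⟩
        rintro ⟨p, q⟩ ⟨hp, rfl⟩
        simpa [mul_comm] using h p hp
    · by_cases hy : y = 0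
      · obtain ⟨b, hb, h⟩ := key x hx (by simpa [hy] using hxy)
        refine ⟨_, _, isOpen_singleton_semifieldTopology hx, isOpen_canonLE_semifieldTopology hb,
          rfl, hy ▸ CanonLE.zero_le b, ?_⟩
        rintro ⟨p, q⟩ ⟨rfl, hq⟩
        exact h q hq
      · refine ⟨_, _, isOpen_singleton_semifieldTopology hx, isOpen_singleton_semifieldTopology hy,
          rfl, rfl, ?_⟩
        rintro ⟨p, q⟩ ⟨rfl, rfl⟩
        exact hxy
  exact { }

end Semifield

/-! ### Continuity over a totally ordered semifield -/

section ContOver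

variable {S A : Type*} [CommSemiring S] [IsTotOrd S] [CommSemiring A] [Algebra S A] {P : RingCon A}

/-- Conversely to `ContOver.exists_small`, a prime is continuous over `S` as soon as the image of
`S` has arbitrarily small nonzero elements. -/
theorem mem_contOver_of_exists_small [Nontrivial S] (hP : IsPrimeCong P)
    (hne : ∃ x : P.Quotient, x ≠ 0 ∧ x ≠ 1)
    (h : ∀ b N : P.Quotient, b ≠ 0 → N ≠ 0 →
      ∃ s : S, s ≠ 0 ∧ CanonLE (P.mk' (algebraMap S A s) * N) b) : P ∈ ContOver S A := by
  refine ⟨hP, hne, ?_⟩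
  have := hP.isTotOrd_residue
  have := hP.nontrivial_residue
  let _ := semifieldTopology (Residue P)
  have := isTopologicalSemiring_semifieldTopology (K := Residue P) fun x => hP.isUnit_residue
  rw [continuous_universalTopology_iff]
  let _ := semifieldTopology S
  refine continuous_generateFrom_iff.2 ?_
  rintro _ ⟨a, ha, rfl | rfl⟩ <;> refine (isOpen_semifieldTopology_iff S _).2 fun h0 => ?_
  · rw [Set.mem_preimage, Function.comp_apply, map_zero, map_zero] at h0
    exact absurd h0.symm ha
  · obtain ⟨b, N, hb, hN, hbN⟩ := hP.exists_frac ha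
    obtain ⟨s, hs, hsb⟩ := h b N hb hN
    refine ⟨s, hs, fun t ht => ?_⟩
    exact (CanonLE.map ((absVal P).comp (algebraMap S A)) ht).trans
      ((hP.canonLE_frac_iff hN hbN).2 hsb)

/-- The image of `S` at a continuous prime has nonzero elements that are strictly smaller than any
given fraction. -/
theorem ContOver.exists_small_lt (hP : P ∈ ContOver S A) {b N : P.Quotient} (hb : b ≠ 0)
    (hN : N ≠ 0) : ∃ s : S, s ≠ 0 ∧ CanonLT (P.mk' (algebraMap S A s) * N) b := by
  have := hP.1.isTotOrd
  obtain ⟨b', N', hb', hN', h⟩ := exists_canonLE_imp_canonLT hP.1.cancel hP.2.1 hb hN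
  obtain ⟨s, hs, hs'⟩ := ContOver.exists_small hP hb' hN'
  exact ⟨s, hs, h _ hs'⟩

end ContOver

/-! ### Primes with bounded terms -/

section TermBound

variable {S : Type v} [CommSemiring S] {M : Type u} [AddCommMonoid M]

/-- The condition `(★)` on `P'` with respect to `P`, phrased without a common value group: the
values of terms are compared with those of the elements of `S` only. -/
def TermBound (P P' : RingCon (AddMonoidAlgebra S M)) : Prop :=
  ∃ c : S, c ≠ 0 ∧ ∀ (u : M) (a s : S),
    CanonLE (tm P u a) (tm P 0 s) → CanonLE (tm P' u a) (tm P' 0 (c * s))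

theorem mk_algebraMap (P : RingCon (AddMonoidAlgebra S M)) (s : S) :
    P.mk' (algebraMap S (AddMonoidAlgebra S M) s) = tm P 0 s := by
  simp [tm]

theorem tm_ne_zero_of_isUnit {P : RingCon (AddMonoidAlgebra S M)} (hP : IsPrimeCong P) {s : S}
    (hs : IsUnit s) : tm P 0 s ≠ 0 := by
  have := hP.nontrivial
  rw [← mk_algebraMap]
  exact ((hs.map (algebraMap S (AddMonoidAlgebra S M))).map P.mk').ne_zero

variable [IsTotOrd S]

/-- Convergence at `P` implies convergence at every continuous prime that satisfies `TermBound`. -/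
theorem Converges.of_termBound (hS : ∀ s : S, s ≠ 0 → IsUnit s)
    {P P' : RingCon (AddMonoidAlgebra S M)} (hP : IsPrimeCong P)
    (hP' : P' ∈ ContOver S (AddMonoidAlgebra S M)) (h : TermBound P P') {f : M → S}
    (hf : Converges P f) : Converges P' f := by
  intro b hb
  have := hP.isTotOrd
  have := hP'.1.nontrivial
  obtain ⟨c, hc, hc'⟩ := h
  obtain ⟨d, hcd⟩ := (hS c hc).exists_right_inv
  -- Terms below `c⁻¹ s` at `P` are below `s`, hence below `b`, at `P'`.
  obtain ⟨s, hs, hsb⟩ := ContOver.exists_small_lt hP' hb one_ne_zero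
  rw [mk_algebraMap, mul_one] at hsb
  have hds : IsUnit (d * s) := (isUnit_of_mul_isUnit_right (hcd ▸ isUnit_one)).mul (hS s hs)
  refine (hf _ (tm_ne_zero_of_isUnit hP hds)).subset fun u hu => ?_
  by_contra hlt
  refine (hsb.not_le) (CanonLE.trans hu ?_)
  have := hc' u (f u) (d * s) (CanonLE.of_not hlt)
  rwa [← mul_assoc, hcd, one_mul] at this

end TermBound

namespace Cnvg

variable {S : Type v} [CommSemiring S] {M : Type u} [AddCommMonoid M]
  {P : ContOverInt S (AddMonoidAlgebra S M)}

/-! ### Truncations and values of series -/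

open Classical in
/-- The polynomial formed by the terms of `f` with exponents in `T`. -/
def trunc (f : Cnvg P) (T : Finset M) : AddMonoidAlgebra S M :=
  ∑ u ∈ T, AddMonoidAlgebra.single u (f.coeff u)

open Classical in
theorem coeff_trunc (f : Cnvg P) (T : Finset M) (u : M) :
    (f.trunc T).coeff u = if u ∈ T then f.coeff u else 0 := by
  simp [trunc, AddMonoidAlgebra.coeff_sum, Finsupp.single_apply]

open Classical in
/-- The series formed by the terms of `f` with exponents outside `T`. -/
def tail (f : Cnvg P) (T : Finset M) : Cnvg P :=
  ⟨fun u => if u ∈ T then 0 else f.coeff u, fun b hb => (f.2 b hb).subset fun u hu => by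
    change CanonLE b (tm P.1 u (if u ∈ T then 0 else f.coeff u)) at hu
    split_ifs at hu
    · rw [tm_zero] at hu
      exact absurd hu.eq_zero hb
    · exact hu⟩

open Classical in
theorem coeff_tail (f : Cnvg P) (T : Finset M) (u : M) :
    (f.tail T).coeff u = if u ∈ T then 0 else f.coeff u := rfl

/-- The value at `P'` of a series which converges there: the maximum of the values of its terms. -/
def extVal (P' : RingCon (AddMonoidAlgebra S M)) (f : Cnvg P) : P'.Quotient :=
  maxOf (Set.range fun u => tm P' u (f.coeff u))

section ExtVal

variable {P' : RingCon (AddMonoidAlgebra S M)} (hP' : IsPrimeCong P')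
  (hc : ∀ f : M → S, Converges P.1 f → Converges P' f)
include hP' hc

theorem extVal_spec (f : Cnvg P) :
    IsMaxOf (Set.range fun u => tm P' u (f.coeff u)) (extVal P' f) := by
  have := hP'.isTotOrd
  apply maxOf_spec
  by_cases h0 : ∀ u, tm P' u (f.coeff u) = 0
  · refine ⟨0, ⟨0, h0 0⟩, ?_⟩
    rintro _ ⟨u, rfl⟩
    exact CanonLE.of_eq (h0 u)
  · push Not at h0
    obtain ⟨u₀, hu₀⟩ := h0
    obtain ⟨i, hi, hmax⟩ := exists_isMaxOf_of_finite (fun u => tm P' u (f.coeff u))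
      (hc _ f.2 _ hu₀) ⟨u₀, CanonLE.refl _⟩
    refine ⟨_, ⟨i, rfl⟩, ?_⟩
    rintro _ ⟨u, rfl⟩
    rcases CanonLE.total (tm P' u₀ (f.coeff u₀)) (tm P' u (f.coeff u)) with h | h
    · exact hmax u h
    · exact h.trans hi

theorem extVal_mul_le_iff (f : Cnvg P) (c z : P'.Quotient) :
    CanonLE (extVal P' f * c) z ↔ ∀ u, CanonLE (tm P' u (f.coeff u) * c) z := by
  obtain ⟨⟨u₀, h₀⟩, hmax⟩ := extVal_spec hP' hc f
  refine ⟨fun h u => ((hmax _ ⟨u, rfl⟩).mul_right c).trans h, fun h => ?_⟩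
  rw [← h₀]
  exact h u₀

theorem extVal_le_iff (f : Cnvg P) (z : P'.Quotient) :
    CanonLE (extVal P' f) z ↔ ∀ u, CanonLE (tm P' u (f.coeff u)) z := by
  simpa using extVal_mul_le_iff hP' hc f 1 z

end ExtVal

variable [IsTotOrd S]

/-! ### Balls and continuous primes of `Cnvg P` -/

theorem mem_ball_zero {g : Cnvg P} {r : Residue P.1} (hr : r ≠ 0)
    (h : ∀ u, CanonLT (algebraMap _ (Residue P.1) (tm P.1 u (g.coeff u))) r) : g ∈ ball 0 r := by
  by_cases hg : g = 0
  · subst hg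
    have h0 : cnvgDist P.1 (0 : Cnvg P).coeff (0 : Cnvg P).coeff = 0 :=
      dif_neg fun ⟨x, hx, _⟩ => by simp at hx
    change CanonLT (cnvgDist _ _ _) r
    rw [h0]
    exact ⟨CanonLE.zero_le r, hr.symm⟩
  · obtain ⟨⟨u, -, hu⟩, -⟩ := dist_spec hg
    change CanonLT (cnvgDist _ _ _) r
    rw [hu, coeff_zero, add_zero]
    exact h u

theorem canonLE_of_mem_ball {f g : Cnvg P} {r : Residue P.1} (h : g ∈ ball f r) {u : M}
    (hu : g.coeff u ≠ f.coeff u) :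
    CanonLE (algebraMap _ (Residue P.1) (tm P.1 u (g.coeff u + f.coeff u))) r := by
  have hgf : g ≠ f := fun e => hu (e ▸ rfl)
  exact ((dist_spec hgf).2 _ ⟨u, hu, rfl⟩).trans h.1

/-- Continuity of `Q`: series whose terms have small enough values at `P` have small values
at `Q`. -/
theorem exists_small {Q : RingCon (Cnvg P)} (hQ : Q ∈ ContSpec (Cnvg P)) {b N : Q.Quotient}
    (hb : b ≠ 0) (hN : N ≠ 0) :
    ∃ s : S, s ≠ 0 ∧ ∀ g : Cnvg P, (∀ u, CanonLE (tm P.1 u (g.coeff u)) (tm P.1 0 s)) →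
      CanonLT (Q.mk' g * N) b := by
  have := hQ.1.isTotOrd
  have := hQ.1.nontrivial_residue
  obtain ⟨b, N, hb, hN, hlt⟩ := exists_canonLE_imp_canonLT hQ.1.cancel hQ.2.1 hb hN
  obtain ⟨z, hz⟩ := (hQ.1.isUnit_algebraMap hN).exists_left_inv
  set a := z * algebraMap _ (Residue Q) b with ha_def
  have haN : a * algebraMap _ (Residue Q) N = algebraMap _ (Residue Q) b := by
    rw [ha_def, mul_right_comm, hz, one_mul]
  have ha : a ≠ 0 := fun h => by
    rw [h, zero_mul] at haN
    exact hb (toResidue_injective Q (by rw [← haN, _root_.map_zero]))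
  obtain ⟨r, hr, hrU⟩ := @Continuous.isOpen_preimage _ _ _ (semifieldTopology _) _ hQ.2.2 _
    (isOpen_canonLE_semifieldTopology ha) 0 (by
      rw [Set.mem_preimage, _root_.map_zero]; exact CanonLE.zero_le a)
  obtain ⟨x, y, hx, hy, hxy⟩ := P.2.1.1.exists_frac hr
  obtain ⟨s, hs, hsx⟩ := ContOver.exists_small_lt P.2.1 hx hy
  rw [mk_algebraMap] at hsx
  refine ⟨s, hs, fun g hg => hlt _ ((hQ.1.canonLE_frac_iff hN haN).1 (hrU ?_))⟩
  refine mem_ball_zero hr fun u => CanonLE.trans_lt (canonLE_algebraMap_residue_iff.2 (hg u)) ?_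
  exact ⟨(P.2.1.1.canonLE_frac_iff hy hxy).2 hsx.1,
    fun e => hsx.2 ((P.2.1.1.eq_frac_iff hy hxy).1 e)⟩

theorem coeff_incl_single [DecidableEq M] (u v : M) (a : S) :
    (incl P (AddMonoidAlgebra.single u a)).coeff v = if u = v then a else 0 := by
  rw [coeff_incl, AddMonoidAlgebra.coeff_single, Finsupp.single_apply]

theorem canonLE_tm_incl_single {u : M} {a : S} {z : P.1.Quotient} (h : CanonLE (tm P.1 u a) z)
    (v : M) : CanonLE (tm P.1 v ((incl P (AddMonoidAlgebra.single u a)).coeff v)) z := by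
  classical
  rw [coeff_incl_single]
  split_ifs with huv
  · exact huv ▸ h
  · rw [tm_zero]
    exact CanonLE.zero_le z

/-! ### The pullback of a continuous prime -/

section Pullback

variable {Q : RingCon (Cnvg P)}

theorem comap_incl_iff (x y : AddMonoidAlgebra S M) :
    Q.comap (incl P) x y ↔ Q.mk'.comp (incl P) x = Q.mk'.comp (incl P) y :=
  (RingCon.eq Q).symm

theorem isPrimeCong_comap_incl (hQ : IsPrimeCong Q) : IsPrimeCong (Q.comap (incl P)) :=
  have := hQ.nontrivial
  have := hQ.isTotOrd
  isPrimeCong_of_hom hQ.cancel comap_incl_iff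

theorem canonLE_tm_comap_iff (u v : M) (a b : S) :
    CanonLE (tm (Q.comap (incl P)) u a) (tm (Q.comap (incl P)) v b) ↔
      CanonLE (Q.mk' (incl P (AddMonoidAlgebra.single u a)))
        (Q.mk' (incl P (AddMonoidAlgebra.single v b))) :=
  canonLE_mk_iff (ψ := Q.mk'.comp (incl P)) comap_incl_iff _ _

variable [Nontrivial S]

/-- Elements of `S` with small values at `P` have small values at `Q`, so the pullback is continuous
over `S`; in particular some of these values are not `1`. -/
theorem comap_incl_mem_contOver (hS : ∀ s : S, s ≠ 0 → IsUnit s) (hQ : Q ∈ ContSpec (Cnvg P)) :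
    Q.comap (incl P) ∈ ContOver S (AddMonoidAlgebra S M) := by
  have := hQ.1.nontrivial
  have hprime := isPrimeCong_comap_incl hQ.1
  refine mem_contOver_of_exists_small hprime ?_ fun b N hb hN => ?_
  · obtain ⟨s, hs, h⟩ := exists_small hQ one_ne_zero one_ne_zero
    refine ⟨tm _ 0 s, tm_ne_zero_of_isUnit hprime (hS s hs), fun h1 => ?_⟩
    have := (h (incl P (AddMonoidAlgebra.single 0 s))
      (canonLE_tm_incl_single (have := P.2.1.1.isTotOrd; CanonLE.refl _))).2
    rw [mul_one] at this
    exact this ((mk_eq_one_iff (ψ := Q.mk'.comp (incl P)) comap_incl_iff _).1 h1)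
  · obtain ⟨b, rfl⟩ := RingCon.mk'_surjective _ b
    obtain ⟨N, rfl⟩ := RingCon.mk'_surjective _ N
    rw [Ne, mk_eq_zero_iff comap_incl_iff] at hb hN
    obtain ⟨s, hs, h⟩ := exists_small hQ hb hN
    refine ⟨s, hs, ?_⟩
    rw [← map_mul, canonLE_mk_iff comap_incl_iff, map_mul]
    refine (h _ ?_).1
    rw [show algebraMap S (AddMonoidAlgebra S M) s = AddMonoidAlgebra.single 0 s by simp]
    exact canonLE_tm_incl_single (have := P.2.1.1.isTotOrd; CanonLE.refl _)

/-- The pullback of a continuous prime satisfies `(★)`: if `e ∈ S` is the radius of a ball around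
`0` with values less than `1`, then `c = e⁻¹` is a bound. -/
theorem termBound_comap_incl (hS : ∀ s : S, s ≠ 0 → IsUnit s) (hQ : Q ∈ ContSpec (Cnvg P)) :
    TermBound P.1 (Q.comap (incl P)) := by
  have := hQ.1.nontrivial
  obtain ⟨e, he, h⟩ := exists_small hQ one_ne_zero one_ne_zero
  obtain ⟨c, hec⟩ := (hS e he).exists_right_inv
  have hcu : IsUnit c := isUnit_of_mul_isUnit_right (hec ▸ isUnit_one)
  refine ⟨c, hcu.ne_zero, fun u a s has => ?_⟩
  by_cases hs : s = 0
  · subst hs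
    rw [tm_zero] at has
    have ha : a = 0 := by
      by_contra ha
      exact tm_ne_zero P.2.2 ha has.eq_zero
    rw [ha, tm_zero]
    exact CanonLE.zero_le _
  · -- Rescale the term by `e / s`, which makes its value at most `e`.
    obtain ⟨t, hst⟩ := (hS s hs).exists_right_inv
    have h1 : CanonLE (tm P.1 u (a * (t * e))) (tm P.1 0 e) := by
      have := has.mul_right (tm P.1 0 (t * e))
      rwa [← tm_mul, ← tm_mul, add_zero, add_zero, ← mul_assoc s, hst, one_mul] at this
    have h2 := (h _ (canonLE_tm_incl_single h1)).1
    rw [mul_one, ← map_one (Q.mk'), ← map_one (incl P)] at h2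
    have h3 : CanonLE (tm (Q.comap (incl P)) u (a * (t * e))) (tm _ 0 1) :=
      (canonLE_tm_comap_iff _ _ _ _).2 h2
    have h4 := h3.mul_right (tm _ 0 (c * s))
    rw [← tm_mul, ← tm_mul, add_zero, add_zero, one_mul] at h4
    rwa [show a * (t * e) * (c * s) = a * (s * t) * (e * c) by ring, hst, hec, mul_one,
      mul_one] at h4

end Pullback

/-! ### Injectivity of the pullback -/

section Truncation

theorem incl_trunc_add_tail (f : Cnvg P) (T : Finset M) :
    incl P (f.trunc T) + f.tail T = f := by
  classical
  refine ext fun u => ?_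
  rw [coeff_add, coeff_incl, coeff_trunc, coeff_tail]
  split_ifs <;> simp

/-- A continuous prime does not distinguish a series from its sufficiently long truncations: the
tail is strictly smaller than the value of the series. -/
theorem exists_trunc {Q : RingCon (Cnvg P)} (hQ : Q ∈ ContSpec (Cnvg P)) (f : Cnvg P) :
    ∃ T₀ : Finset M, ∀ T, T₀ ⊆ T → Q f (incl P (f.trunc T)) := by
  classical
  have := hQ.1.isTotOrd
  have := hQ.1.nontrivial
  have := P.2.1.1.isTotOrd
  by_cases hf : Q.mk' f = 0
  · refine ⟨∅, fun T _ => (RingCon.eq Q).1 (hf.trans ?_)⟩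
    have h := congrArg Q.mk' (incl_trunc_add_tail f T)
    rw [map_add, hf] at h
    exact (h ▸ CanonLE.le_add_left (Q.mk' (incl P (f.trunc T))) _).eq_zero.symm
  · obtain ⟨s, hs, h⟩ := exists_small hQ hf one_ne_zero
    have hfin := f.2 _ (tm_ne_zero P.2.2 (u := 0) hs)
    refine ⟨hfin.toFinset, fun T hT => (RingCon.eq Q).1 ?_⟩
    have hlt := h (f.tail T) fun u => by
      rw [coeff_tail]
      split_ifs with hu
      · rw [tm_zero]
        exact CanonLE.zero_le _
      · exact CanonLE.of_not fun hc => hu (hT (hfin.mem_toFinset.2 hc))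
    have hsum := congrArg Q.mk' (incl_trunc_add_tail f T)
    rw [map_add] at hsum
    rw [mul_one] at hlt
    rcases IsTotOrd.add_eq_or (Q.mk' (incl P (f.trunc T))) (Q.mk' (f.tail T)) with e | e
    · exact hsum.symm.trans e
    · exact absurd (e.symm.trans hsum) hlt.2

theorem le_of_comap_incl_eq {Q Q' : RingCon (Cnvg P)} (hQ : Q ∈ ContSpec (Cnvg P))
    (hQ' : Q' ∈ ContSpec (Cnvg P)) (h : Q.comap (incl P) = Q'.comap (incl P)) {f g : Cnvg P}
    (hfg : Q f g) : Q' f g := by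
  classical
  obtain ⟨T₁, h₁⟩ := exists_trunc hQ f
  obtain ⟨T₂, h₂⟩ := exists_trunc hQ g
  obtain ⟨T₃, h₃⟩ := exists_trunc hQ' f
  obtain ⟨T₄, h₄⟩ := exists_trunc hQ' g
  set T := T₁ ∪ T₂ ∪ (T₃ ∪ T₄)
  have key : Q (incl P (f.trunc T)) (incl P (g.trunc T)) :=
    Q.trans (Q.symm (h₁ T (by grind))) (Q.trans hfg (h₂ T (by grind)))
  have key' : Q' (incl P (f.trunc T)) (incl P (g.trunc T)) := by
    change Q'.comap (incl P) _ _
    rw [← h]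
    exact key
  exact Q'.trans (h₃ T (by grind)) (Q'.trans key' (Q'.symm (h₄ T (by grind))))

theorem injOn_comap_incl :
    Set.InjOn (fun Q : RingCon (Cnvg P) => Q.comap (incl P)) (ContSpec (Cnvg P)) :=
  fun _ hQ _ hQ' h => RingCon.ext fun _ _ =>
    ⟨le_of_comap_incl_eq hQ hQ' h, le_of_comap_incl_eq hQ' hQ h.symm⟩

end Truncation

/-! ### Extension of a prime to convergent power series -/

section Extension

variable {P' : RingCon (AddMonoidAlgebra S M)} (hP' : IsPrimeCong P')
  (hc : ∀ f : M → S, Converges P.1 f → Converges P' f)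
include hP' hc

theorem extVal_incl (p : AddMonoidAlgebra S M) : extVal P' (incl P p) = P'.mk' p := by
  classical
  have := hP'.isTotOrd
  have hadd : ∀ f g : Cnvg P, extVal P' (f + g) = extVal P' f + extVal P' g := fun f g => by
    refine eq_of_forall_canonLE_iff fun z => ?_
    simp only [canonLE_add_iff, extVal_le_iff hP' hc, coeff_add, tm_add, forall_and]
  induction p using AddMonoidAlgebra.induction_linear with
  | zero =>
    rw [_root_.map_zero, _root_.map_zero]
    refine CanonLE.eq_zero ((extVal_le_iff hP' hc _ _).2 fun u => ?_)
    rw [coeff_zero, tm_zero]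
    exact CanonLE.zero_le _
  | add p q hp hq => rw [map_add, hadd, hp, hq, map_add]
  | single u a =>
    refine eq_of_forall_canonLE_iff fun z => ?_
    rw [extVal_le_iff hP' hc]
    simp only [coeff_incl_single]
    refine ⟨fun h => by simpa [tm] using h u, fun h v => ?_⟩
    split_ifs with huv
    · exact huv ▸ h
    · rw [tm_zero]
      exact CanonLE.zero_le _

/-- The extension of `S[M] → S[M] / P'` to convergent power series, `f ↦ max |f_u χ^u|_{P'}`. -/
def extHom : Cnvg P →+* P'.Quotient where
  toFun := extVal P'
  map_zero' := by
    rw [← _root_.map_zero (incl P), extVal_incl hP' hc, _root_.map_zero]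
  map_one' := by
    rw [← map_one (incl P), extVal_incl hP' hc, map_one]
  map_add' f g := by
    have := hP'.isTotOrd
    refine eq_of_forall_canonLE_iff fun z => ?_
    simp only [canonLE_add_iff, extVal_le_iff hP' hc, coeff_add, tm_add, forall_and]
  map_mul' f g := by
    have := hP'.isTotOrd
    refine eq_of_forall_canonLE_iff fun z => ?_
    rw [extVal_le_iff hP' hc, extVal_mul_le_iff hP' hc]
    have : (∀ v, CanonLE (tm P' v (f.coeff v) * extVal P' g) z) ↔
        ∀ v w, CanonLE (tm P' v (f.coeff v) * tm P' w (g.coeff w)) z := by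
      refine forall_congr' fun v => ?_
      rw [mul_comm, extVal_mul_le_iff hP' hc]
      simp only [mul_comm]
    rw [this]
    constructor
    · intro h v w
      refine CanonLE.trans ?_ (h (v + w))
      rw [← tm_mul]
      exact tm_mono _ _ ((mulCoeff_spec P.2 f.2 g.2 (v + w)).2 _ ⟨v, w, rfl, rfl⟩)
    · intro h u
      obtain ⟨⟨v, w, rfl, he⟩, -⟩ := mulCoeff_spec P.2 f.2 g.2 u
      rw [coeff_mul]
      change mulCoeff f.coeff g.coeff (v + w) = f.coeff v * g.coeff w at he
      rw [he, tm_mul]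
      exact h v w

theorem extHom_le_iff (f : Cnvg P) (z : P'.Quotient) :
    CanonLE (extHom hP' hc f) z ↔ ∀ u, CanonLE (tm P' u (f.coeff u)) z :=
  extVal_le_iff hP' hc f z

theorem extHom_incl (p : AddMonoidAlgebra S M) : extHom hP' hc (incl P p) = P'.mk' p :=
  extVal_incl hP' hc p

theorem comap_incl_ker_extHom : (RingCon.ker (extHom hP' hc)).comap (incl P) = P' := by
  refine RingCon.ext fun p q => ?_
  rw [RingCon.comap_rel, RingCon.ker_apply, extHom_incl, extHom_incl]
  exact RingCon.eq P'

/-- A bound `z` on the terms at `P'` of all coefficients in which `f` and `g` differ bounds the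
amount by which their values differ. -/
theorem extHom_le_add {f g : Cnvg P} {z : P'.Quotient}
    (h : ∀ u, g.coeff u ≠ f.coeff u → CanonLE (tm P' u (g.coeff u + f.coeff u)) z) :
    CanonLE (extHom hP' hc g) (extHom hP' hc f + z) := by
  have := hP'.isTotOrd
  rw [extHom_le_iff]
  intro u
  by_cases hu : g.coeff u = f.coeff u
  · rw [hu]
    exact CanonLE.trans ((extHom_le_iff hP' hc f _).1 (CanonLE.refl _) u) (CanonLE.le_add_left _ _)
  · exact ((tm_mono P' u (CanonLE.le_add_left _ _)).trans (h u hu)).trans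
      (CanonLE.le_add_right _ _)

end Extension

/-- The kernel of the extension is continuous: by `TermBound`, on a small ball around `f` the terms
in which a series differs from `f` are small at `P'`. -/
theorem ker_extHom_mem_contSpec (hS : ∀ s : S, s ≠ 0 → IsUnit s)
    {P' : RingCon (AddMonoidAlgebra S M)} (hP' : P' ∈ ContOver S (AddMonoidAlgebra S M))
    (hb : TermBound P.1 P')
    (hc : ∀ f : M → S, Converges P.1 f → Converges P' f) :
    RingCon.ker (extHom (P := P) hP'.1 hc) ∈ ContSpec (Cnvg P) := by
  have := hP'.1.isTotOrd
  have := hP'.1.nontrivial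
  set ψ := extHom (P := P) hP'.1 hc
  set Q := RingCon.ker ψ
  have hQ : ∀ x y, Q x y ↔ ψ x = ψ y := fun x y => RingCon.ker_apply ψ
  have hprime : IsPrimeCong Q := isPrimeCong_of_hom hP'.1.cancel hQ
  refine ⟨hprime, ?_, ?_⟩
  · obtain ⟨x, hx0, hx1⟩ := hP'.2.1
    obtain ⟨x, rfl⟩ := P'.mk'_surjective x
    refine ⟨Q.mk' (incl P x), ?_, ?_⟩
    · rwa [Ne, mk_eq_zero_iff hQ, extHom_incl]
    · rwa [Ne, mk_eq_one_iff hQ, extHom_incl]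
  · obtain ⟨c, hc0, hcb⟩ := hb
    obtain ⟨d, hcd⟩ := (hS c hc0).exists_right_inv
    refine @continuous_generateFrom_iff _ _ _ _ _ |>.2 ?_
    -- On a small ball the values of two series agree up to less than a given element.
    have key : ∀ a : Residue Q, a ≠ 0 → ∃ X Y : Cnvg P, ∃ r : Residue P.1, r ≠ 0 ∧
        (∀ f, CanonLE (absVal Q f) a ↔ CanonLE (ψ f * ψ Y) (ψ X)) ∧
        (∀ f, absVal Q f = a ↔ ψ f * ψ Y = ψ X) ∧
        ∃ z, CanonLT z (ψ X) ∧ ∀ f g, g ∈ ball f r →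
          CanonLE (ψ g * ψ Y) (ψ f * ψ Y + z) ∧ CanonLE (ψ f * ψ Y) (ψ g * ψ Y + z) := by
      intro a ha
      obtain ⟨X, Y, hX, hY, hXY⟩ := hprime.exists_frac ha
      obtain ⟨X, rfl⟩ := Q.mk'_surjective X
      obtain ⟨Y, rfl⟩ := Q.mk'_surjective Y
      have hX' := hX
      have hY' := hY
      rw [Ne, mk_eq_zero_iff hQ] at hX' hY'
      obtain ⟨s, hs, hsb⟩ := ContOver.exists_small_lt hP' hX' hY'
      rw [mk_algebraMap] at hsb
      have hds : IsUnit (d * s) := (isUnit_of_mul_isUnit_right (hcd ▸ isUnit_one)).mul (hS s hs)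
      refine ⟨X, Y, algebraMap _ _ (tm P.1 0 (d * s)), fun h => ?_, fun f => ?_, fun f => ?_,
        tm P' 0 s * ψ Y, hsb, fun f g hg => ?_⟩
      · exact tm_ne_zero_of_isUnit P.2.1.1 hds
          (toResidue_injective P.1 (by rw [h, _root_.map_zero]))
      · rw [← map_mul, ← canonLE_mk_iff hQ, map_mul]
        exact hprime.canonLE_frac_iff hY hXY
      · rw [← map_mul, ← hQ, ← RingCon.eq]
        exact hprime.eq_frac_iff hY hXY
      · have hle : ∀ u, g.coeff u ≠ f.coeff u →
            CanonLE (tm P' u (g.coeff u + f.coeff u)) (tm P' 0 s) := fun u hu => by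
          have := hcb u _ (d * s)
            (canonLE_algebraMap_residue_iff.1 (canonLE_of_mem_ball hg hu))
          rwa [← mul_assoc, hcd, one_mul] at this
        rw [← add_mul, ← add_mul]
        refine ⟨(extHom_le_add hP'.1 hc hle).mul_right _,
          (extHom_le_add hP'.1 hc fun u hu => ?_).mul_right _⟩
        rw [add_comm]
        exact hle u hu.symm
    rintro _ ⟨a, ha, rfl | rfl⟩ f hf <;>
      obtain ⟨X, Y, r, hr, hle, heq, z, hz, hball⟩ := key a ha <;>
      refine ⟨r, hr, fun g hg => ?_⟩
    · have hf' : ψ f * ψ Y = ψ X := (heq f).1 hf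
      refine (heq g).2 ?_
      obtain ⟨h1, h2⟩ := hball f g hg
      rw [hf'] at h1 h2
      rw [add_comm, hz.1] at h1
      refine h1.antisymm ?_
      rcases IsTotOrd.add_eq_or (ψ g * ψ Y) z with e | e <;> rw [e] at h2
      · exact h2
      · exact absurd h2 hz.not_le
    · have hf' : CanonLE (ψ f * ψ Y) (ψ X) := (hle f).1 hf
      exact (hle g).2 ((hball f g hg).1.trans (canonLE_add_iff.2 ⟨hf', hz.1⟩))

theorem bijOn_comap_incl [Nontrivial S] (hS : ∀ s : S, s ≠ 0 → IsUnit s) :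
    Set.BijOn (fun Q : RingCon (Cnvg P) => Q.comap (incl P)) (ContSpec (Cnvg P))
      {P' | P' ∈ ContOver S (AddMonoidAlgebra S M) ∧ TermBound P.1 P'} := by
  refine ⟨fun Q hQ => ⟨comap_incl_mem_contOver hS hQ, termBound_comap_incl hS hQ⟩,
    injOn_comap_incl, ?_⟩
  rintro P' ⟨hP', hb⟩
  have hc : ∀ f : M → S, Converges P.1 f → Converges P' f := fun f hf =>
    hf.of_termBound hS P.2.1.1 hP' hb
  exact ⟨_, ker_extHom_mem_contSpec hS hP' hb hc, comap_incl_ker_extHom hP'.1 hc⟩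

end Cnvg

/-! ### Sub-semifields of the tropical semifield -/

section Subsemifield

theorem MaxPlus.t_mul {G : Type*} [AddCommGroup G] [LinearOrder G] [IsOrderedAddMonoid G]
    (a b : G) : t (a + b) = t a * t b := rfl

theorem MaxPlus.t_zero {G : Type*} [AddCommGroup G] [LinearOrder G] [IsOrderedAddMonoid G] :
    t (0 : G) = 1 := rfl

theorem MaxPlus.t_ne_zero {G : Type*} [AddCommGroup G] [LinearOrder G] [IsOrderedAddMonoid G]
    (a : G) : t a ≠ 0 := WithZero.coe_ne_zero

theorem MaxPlus.t_injective {G : Type*} : Function.Injective (t : G → MaxPlus G) :=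
  fun _ _ h => Multiplicative.ofAdd.injective (WithZero.coe_injective h)

theorem MaxPlus.t_le_t {G : Type*} [AddCommGroup G] [LinearOrder G] [IsOrderedAddMonoid G]
    {a b : G} : t a ≤ t b ↔ a ≤ b := WithZero.coe_le_coe

theorem MaxPlus.exists_eq_t {G : Type*} [AddCommGroup G] [LinearOrder G] [IsOrderedAddMonoid G]
    {x : MaxPlus G} (hx : x ≠ 0) : ∃ a : G, x = t a := by
  obtain ⟨a, ha⟩ := WithZero.ne_zero_iff_exists.1 hx
  exact ⟨a.toAdd, ha.symm⟩

variable {S : Subsemiring Trop}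

theorem canonLE_coe_iff {a b : S} : CanonLE a b ↔ (a : Trop) ≤ b := by
  rw [← MaxPlus.canonLE_iff]
  exact Subtype.ext_iff

theorem IsSubsemifield.isUnit (hS : IsSubsemifield S) (s : S) (hs : s ≠ 0) : IsUnit s := by
  have hs' : (s : Trop) ≠ 0 := fun h => hs (Subtype.ext h)
  exact .of_mul_eq_one ⟨_, hS s s.2 hs'⟩ (Subtype.ext (mul_inv_cancel₀ hs'))

instance (S : Subsemiring Trop) : Nontrivial S :=
  ⟨⟨0, 1, fun h => zero_ne_one (α := Trop) (congrArg Subtype.val h)⟩⟩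

theorem exists_canonLE_pow (hS : IsSubsemifield S) {a d : S} (ha : a ≠ 0) (hd : CanonLT 1 d)
    (b : S) : ∃ n : ℕ, CanonLE b (a * d ^ n) := by
  obtain ⟨a', haa⟩ := (hS.isUnit a ha).exists_right_inv
  have hd' : (1 : Trop) < d :=
    lt_of_le_of_ne (canonLE_coe_iff.1 hd.1) fun h => hd.2 (Subtype.ext h)
  have : MulArchimedean Trop := inferInstanceAs (MulArchimedean (WithZero (Multiplicative ℝ)))
  obtain ⟨n, hn⟩ := MulArchimedean.arch ((b * a' : S) : Trop) hd'
  refine ⟨n, ?_⟩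
  have h : CanonLE (b * a') (d ^ n) := canonLE_coe_iff.2 (by simpa using hn)
  have := h.mul_left a
  rwa [mul_left_comm, haa, mul_one] at this

theorem exists_one_canonLT (hS : IsSubsemifield S) (hSB : ∃ x ∈ S, x ≠ 0 ∧ x ≠ 1) :
    ∃ d : S, CanonLT 1 d := by
  obtain ⟨x, hx, hx0, hx1⟩ := hSB
  have hx0' : (⟨x, hx⟩ : S) ≠ 0 := fun h => hx0 (congrArg Subtype.val h)
  obtain ⟨y, hxy⟩ := (hS.isUnit _ hx0').exists_right_inv
  have hx1' : (⟨x, hx⟩ : S) ≠ 1 := fun h => hx1 (congrArg Subtype.val h)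
  rcases CanonLE.total (1 : S) ⟨x, hx⟩ with h | h
  · exact ⟨_, h, hx1'.symm⟩
  · refine ⟨y, ?_, fun h1 => hx1' ?_⟩
    · have := h.mul_right y
      rwa [hxy, one_mul] at this
    · rwa [← h1, mul_one] at hxy

variable {M : Type u} [AddCommMonoid M] {P : RingCon (AddMonoidAlgebra S M)}

theorem tm_zero_pow (P : RingCon (AddMonoidAlgebra S M)) (s : S) (n : ℕ) :
    tm P 0 (s ^ n) = tm P 0 s ^ n := by
  rw [← mk_algebraMap, ← mk_algebraMap, map_pow, map_pow]

theorem tm_zero_one (P : RingCon (AddMonoidAlgebra S M)) : tm P 0 (1 : S) = 1 := by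
  rw [← mk_algebraMap, map_one, map_one]

theorem tm_zero_mul (P : RingCon (AddMonoidAlgebra S M)) (s s' : S) :
    tm P 0 (s * s') = tm P 0 s * tm P 0 s' := by
  rw [← tm_mul, add_zero]

/-- At a continuous prime, the values of the elements of `S` are cofinal. -/
theorem exists_canonLE_tm (hS : IsSubsemifield S) (hP : P ∈ ContOver S (AddMonoidAlgebra S M))
    {x y : P.Quotient} (hy : y ≠ 0) : ∃ s : S, s ≠ 0 ∧ CanonLE x (tm P 0 s * y) := by
  have := hP.1.isTotOrd
  have := hP.1.nontrivial
  by_cases hx : x = 0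
  · exact ⟨1, one_ne_zero, hx ▸ CanonLE.zero_le _⟩
  · obtain ⟨s, hs, h⟩ := ContOver.exists_small hP hy hx
    obtain ⟨s', hss⟩ := (hS.isUnit s hs).exists_left_inv
    refine ⟨s', (isUnit_of_mul_isUnit_left (hss ▸ isUnit_one)).ne_zero, ?_⟩
    have := h.mul_left (tm P 0 s')
    rwa [mk_algebraMap, ← mul_assoc, ← tm_zero_mul, hss, tm_zero_one, one_mul] at this

/-- Values at a continuous prime can be approximated by values of `S` up to a fixed factor. -/
theorem exists_round (hS : IsSubsemifield S) (hP : P ∈ ContOver S (AddMonoidAlgebra S M))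
    {d : S} (hd : CanonLT 1 d) {x : P.Quotient} (hx : x ≠ 0) :
    ∃ s : S, CanonLE x (tm P 0 s) ∧ CanonLE (tm P 0 s) (tm P 0 d * x) := by
  classical
  have := hP.1.isTotOrd
  have := hP.1.nontrivial
  obtain ⟨a, ha, hax⟩ := ContOver.exists_small hP hx one_ne_zero
  rw [mk_algebraMap, mul_one] at hax
  obtain ⟨b, -, hxb⟩ := exists_canonLE_tm hS hP (x := x) one_ne_zero
  rw [mul_one] at hxb
  have hex : ∃ n : ℕ, CanonLE x (tm P 0 (a * d ^ n)) := by
    obtain ⟨n, hn⟩ := exists_canonLE_pow hS ha hd b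
    exact ⟨n, hxb.trans (tm_mono P 0 hn)⟩
  refine ⟨a * d ^ Nat.find hex, Nat.find_spec hex, ?_⟩
  rcases hn : Nat.find hex with _ | n
  · rw [pow_zero, mul_one]
    refine hax.trans ?_
    have := (tm_mono P 0 hd.1).mul_right x
    rwa [tm_zero_one, one_mul] at this
  · have h1 := CanonLE.of_not (Nat.find_min hex (hn.symm ▸ Nat.lt_succ_self n : n < Nat.find hex))
    rw [pow_succ', mul_left_comm, tm_zero_mul]
    exact h1.mul_left _

/-- An element of `S` greater than `1` has a value greater than `1` at every continuous prime: its
powers are cofinal in `S`. -/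
theorem tm_ne_one (hS : IsSubsemifield S) (hP : P ∈ ContOver S (AddMonoidAlgebra S M)) {d : S}
    (hd : CanonLT 1 d) : tm P 0 d ≠ 1 := by
  have := hP.1.isTotOrd
  have := hP.1.nontrivial
  intro h
  obtain ⟨e, he, hlt⟩ := ContOver.exists_small_lt hP (b := 1) (N := 1) one_ne_zero one_ne_zero
  rw [mk_algebraMap, mul_one] at hlt
  obtain ⟨n, hn⟩ := exists_canonLE_pow hS he hd 1
  have := tm_mono P 0 hn
  rw [tm_zero_one, tm_zero_mul, tm_zero_pow, h, one_pow, mul_one] at this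
  exact hlt.not_le this

/-! ### Independence of the joint Hahn embedding -/

/-- The restriction to `A / P` of a homomorphism on `κ(P)`. -/
def quotientHom {A R : Type*} [CommSemiring A] [CommSemiring R] (P : RingCon A)
    (φ : Residue P →+* R) : P.Quotient →+* R :=
  φ.comp (algebraMap P.Quotient (Residue P))

theorem canonLE_quotientHom_iff {A R : Type*} [CommSemiring A] [CommSemiring R] {P : RingCon A}
    {φ : Residue P →+* R} (hφ : Function.Injective φ) {a b : P.Quotient} :
    CanonLE (quotientHom P φ a) (quotientHom P φ b) ↔ CanonLE a b := by
  unfold CanonLE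
  rw [← map_add]
  exact (hφ.comp (toResidue_injective P)).eq_iff

/-- Condition `(★)` does not depend on the joint Hahn embedding. -/
theorem JointHahnEmbedding.star_iff (hS : IsSubsemifield S) (hSB : ∃ x ∈ S, x ≠ 0 ∧ x ≠ 1)
    (hP : P ∈ ContOverInt S (AddMonoidAlgebra S M)) {P' : RingCon (AddMonoidAlgebra S M)}
    (E : JointHahnEmbedding S P P') : E.Star ↔ TermBound P P' := by
  let v := quotientHom P E.φ
  let v' := quotientHom P' E.φ'
  have hv {a b : P.Quotient} : CanonLE (v a) (v b) ↔ CanonLE a b :=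
    canonLE_quotientHom_iff E.φ_injective
  have hv' {a b : P'.Quotient} : CanonLE (v' a) (v' b) ↔ CanonLE a b :=
    canonLE_quotientHom_iff E.φ'_injective
  have hj : ∀ s : S, jMap E.I s = v (tm P 0 s) := fun s => by
    rw [← E.φ_algebraMap, ← mk_algebraMap]
    rfl
  have hj' : ∀ s : S, jMap E.I s = v' (tm P' 0 s) := fun s => by
    rw [← E.φ'_algebraMap, ← mk_algebraMap]
    rfl
  have hstar : E.Star ↔ ∃ c : S, c ≠ 0 ∧ ∀ (u : M) (a : S),
      CanonLE (v' (tm P' u a)) (jMap E.I c * v (tm P u a)) := by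
    simp only [MaxPlus.canonLE_iff]
    rfl
  rw [hstar]
  constructor
  · rintro ⟨c, hc, h⟩
    refine ⟨c, hc, fun u a s has => hv'.1 ((h u a).trans ?_)⟩
    rw [tm_zero_mul, map_mul, ← hj', ← hj', hj s]
    exact CanonLE.mul_left (hv.2 has) _
  · rintro ⟨c, hc, h⟩
    obtain ⟨d, hd⟩ := exists_one_canonLT hS hSB
    have hd0 : d ≠ 0 := by
      rintro rfl
      exact hd.2 hd.1.eq_zero
    refine ⟨c * d, ((hS.isUnit c hc).mul (hS.isUnit d hd0)).ne_zero, fun u a => ?_⟩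
    by_cases ha : a = 0
    · subst ha
      rw [tm_zero, map_zero]
      exact CanonLE.zero_le _
    · obtain ⟨s, has, hsa⟩ := exists_round hS hP.1 hd (tm_ne_zero hP.2 (u := u) ha)
      refine CanonLE.trans (hv'.2 (h u a s has)) ?_
      rw [← hj', hj, hj, ← map_mul]
      refine hv.2 ?_
      rw [tm_zero_mul, tm_zero_mul, mul_assoc]
      exact hsa.mul_left _

end Subsemifield

/-! ### Hahn embeddings over a subgroup of the reals -/

section Hahn

/-- Positive homomorphisms from a subgroup of `ℝ` to `ℝ` are multiplications by constants. -/
theorem AddSubgroup.map_mul_eq_of_nonneg (T : AddSubgroup ℝ) (q : T →+ ℝ)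
    (hq : ∀ t : T, 0 ≤ (t : ℝ) → 0 ≤ q t) {t₀ : T} (ht₀ : 0 < (t₀ : ℝ)) (t : T) :
    q t * t₀ = q t₀ * t := by
  have key : ∀ t : T, q t₀ * t ≤ q t * t₀ := fun t => by
    by_contra! hlt
    obtain ⟨n, hn⟩ := exists_nat_gt (q t₀ * t₀ / (q t₀ * t - q t * t₀))
    rw [div_lt_iff₀ (sub_pos.2 hlt)] at hn
    -- `m t₀` is the multiple of `t₀` next to `n t` from below.
    set m := ⌊(n * t : ℝ) / t₀⌋
    have h1 : (m : ℝ) * t₀ ≤ n * t := (le_div_iff₀ ht₀).1 (Int.floor_le _)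
    have h2 : (n : ℝ) * t < (m + 1) * t₀ := (div_lt_iff₀ ht₀).1 (Int.lt_floor_add_one _)
    have h3 := hq (n • t - m • t₀) (by simpa using h1)
    rw [map_sub, map_nsmul, map_zsmul, nsmul_eq_mul, zsmul_eq_mul] at h3
    have h4 := mul_nonneg h3 ht₀.le
    have h5 := mul_le_mul_of_nonneg_left h2.le (hq t₀ ht₀.le)
    nlinarith
  have := key (-t)
  rw [map_neg] at this
  push_cast at this
  exact le_antisymm (by linarith) (key t)

/-- Homomorphisms to a rational vector space extend from a subgroup of `ℝ` to `ℝ`. -/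
theorem exists_extend_of_module_rat {D : Type*} [AddCommGroup D] [Module ℚ D]
    (T : AddSubgroup ℝ) (g : T →+ D) : ∃ h : ℝ →+ D, ∀ t : T, h t = g t := by
  let _ : DivisibleBy D ℤ :=
    { div := fun a n => (n : ℚ)⁻¹ • a
      div_zero := fun a => by simp
      div_cancel := fun {n} a hn => by
        rw [← Int.cast_smul_eq_zsmul ℚ, smul_smul, mul_inv_cancel₀ (by exact_mod_cast hn),
          one_smul] }
  obtain ⟨h, hh⟩ := (Module.Baer.of_divisible D).extension_property_addMonoidHom T.subtype
    Subtype.val_injective g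
  exact ⟨h, fun t => DFunLike.congr_fun hh t⟩

variable {G : Type u} [AddCommGroup G] [LinearOrder G] [IsOrderedAddMonoid G]
  {T : AddSubgroup ℝ} {ι : T →+ G}

/-- If a nontrivial subgroup `T` of `ℝ` is cofinal in `G`, the coefficient of a Hahn embedding of
`G` at the exponent that belongs to the class of `T` is, up to a scalar, the identity on `T`; the
other coefficients of the elements of `T` can be removed by a shear. -/
theorem exists_hahn_splitting (hι : ∀ t : T, 0 < (t : ℝ) → 0 < ι t)
    (hT : ∃ t : T, 0 < (t : ℝ)) (hcof : ∀ g : G, ∃ t : T, g ≤ ι t) :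
    ∃ (r : G →+ ℝ) (f : G →+ Lex (HahnSeries (FiniteArchimedeanClass G) ℝ)),
      (∀ x, 0 < x → 0 < r x ∨ r x = 0 ∧ 0 < f x) ∧ ∀ t : T, r (ι t) = t ∧ f (ι t) = 0 := by
  obtain ⟨t₀, ht₀⟩ := hT
  obtain ⟨f, hf, hclass⟩ := hahnEmbedding_isOrderedAddMonoid G
  have hpos : ∀ x, 0 < x → 0 < f x := fun x hx =>
    lt_of_le_of_ne (by simpa using f.monotone' hx.le) fun h => hx.ne (hf (by simpa using h))
  have hmono : ∀ t : T, 0 ≤ (t : ℝ) → 0 ≤ ι t := fun t ht => by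
    rcases ht.eq_or_lt with h | h
    · have : t = 0 := Subtype.ext h.symm
      simp [this]
    · exact (hι t h).le
  -- By cofinality `ι t₀` is in the least class, so all Hahn series start at `i₀` or later.
  have hle : ∀ g, ArchimedeanClass.mk (ι t₀) ≤ ArchimedeanClass.mk g := fun g => by
    rw [ArchimedeanClass.mk_le_mk]
    obtain ⟨t, ht⟩ := hcof |g|
    obtain ⟨n, hn⟩ := Archimedean.arch (t : ℝ) ht₀
    refine ⟨n, ht.trans ?_⟩
    rw [abs_of_pos (hι t₀ ht₀), ← sub_nonneg, ← map_nsmul, ← map_sub]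
    exact hmono _ (by simpa using hn)
  obtain ⟨i₀, hi₀⟩ : ∃ i₀ : FiniteArchimedeanClass G, (ofLex (f (ι t₀))).orderTop = i₀ := by
    have : ofLex (f (ι t₀)) ≠ 0 := (hpos _ (hι t₀ ht₀)).ne'
    exact ⟨_, HahnSeries.orderTop_of_ne_zero this⟩
  have hzero : ∀ g, ∀ j < i₀, (ofLex (f g)).coeff j = 0 := fun g j hj => by
    refine HahnSeries.coeff_eq_zero_of_lt_orderTop (lt_of_lt_of_le (WithTop.coe_lt_coe.2 hj) ?_)
    rw [← hi₀, ← (FiniteArchimedeanClass.withTopOrderIso G).le_iff_le, ← hclass, ← hclass]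
    exact hle g
  let r₀ : G →+ ℝ :=
    { toFun := fun g => (ofLex (f g)).coeff i₀
      map_zero' := by simp
      map_add' := fun a b => by simp }
  have hr₀ : ∀ x, 0 < x → 0 ≤ r₀ x := fun x hx => by
    obtain ⟨i, hi, hi'⟩ := (HahnSeries.lt_iff _ _).1 (hpos x hx)
    rcases lt_trichotomy i i₀ with h | rfl | h
    · rw [hzero x i h] at hi'
      exact absurd hi' (lt_irrefl 0)
    · exact hi'.le
    · exact (hi i₀ h).le
  have hc : 0 < r₀ (ι t₀) := by
    refine lt_of_le_of_ne (hr₀ _ (hι t₀ ht₀)) fun h => ?_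
    exact HahnSeries.coeff_orderTop_ne hi₀ h.symm
  have hscale : ∀ t : T, r₀ (ι t) * t₀ = r₀ (ι t₀) * t :=
    AddSubgroup.map_mul_eq_of_nonneg T (r₀.comp ι) (fun t ht => by
      rcases (hmono t ht).eq_or_lt with h | h
      · simp [← h]
      · exact hr₀ _ h) ht₀
  let r : G →+ ℝ := (AddMonoidHom.mulLeft ((t₀ : ℝ) / r₀ (ι t₀))).comp r₀
  have hr : ∀ x, r x = t₀ / r₀ (ι t₀) * r₀ x := fun x => rfl
  have hrt : ∀ t : T, r (ι t) = t := fun t => by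
    rw [hr, div_mul_eq_mul_div, mul_comm, hscale, mul_div_cancel_left₀ _ hc.ne']
  obtain ⟨h, hh⟩ := exists_extend_of_module_rat T (f.toAddMonoidHom.comp ι)
  refine ⟨r, f.toAddMonoidHom - h.comp r, fun x hx => ?_, fun t => ⟨hrt t, ?_⟩⟩
  · rcases (hr₀ x hx).eq_or_lt with h0 | h0
    · have hrx : r x = 0 := by rw [hr, ← h0, mul_zero]
      refine Or.inr ⟨hrx, ?_⟩
      simpa [hrx] using hpos x hx
    · exact Or.inl (mul_pos (div_pos ht₀ hc) h0)
  · simp [hrt, hh]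

/-- A Hahn embedding of `G` over any set of exponents which contains the Archimedean classes of `G`
and a further element `⊥` below them, such that `T` is embedded as the factor of `⊥`. -/
theorem exists_hahn_embedding (hι : ∀ t : T, 0 < (t : ℝ) → 0 < ι t)
    (hT : ∃ t : T, 0 < (t : ℝ)) (hcof : ∀ g : G, ∃ t : T, g ≤ ι t)
    {I : Type*} [LinearOrder I] [OrderBot I] (e : FiniteArchimedeanClass G ↪o I)
    (he : ∀ i, e i ≠ ⊥) :
    ∃ F : G →+ Lex (HahnSeries I ℝ), (∀ x, 0 < x → 0 < F x) ∧
      ∀ t : T, F (ι t) = toLex (HahnSeries.single ⊥ (t : ℝ)) := by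
  obtain ⟨r, f, hpos, ht⟩ := exists_hahn_splitting hι hT hcof
  let L : ℝ →+ Lex (HahnSeries I ℝ) :=
    { toFun := fun a => toLex (HahnSeries.single ⊥ a)
      map_zero' := by simp
      map_add' := fun a b => by simp }
  refine ⟨L.comp r + (HahnSeries.embDomainOrderAddMonoidHom e).toAddMonoidHom.comp f,
    fun x hx => ?_, fun t => ?_⟩
  · rcases hpos x hx with h | ⟨h, h'⟩
    · refine (HahnSeries.lt_iff _ _).2 ⟨⊥, fun j hj => absurd hj not_lt_bot, ?_⟩
      have hb : (⊥ : I) ∉ Set.range e := fun ⟨i, hi⟩ => he i hi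
      simpa [L, HahnSeries.embDomain_of_notMem_range hb] using h
    · have := (HahnSeries.embDomainOrderEmbedding (R := ℝ) e).strictMono h'
      simpa [L, h] using this
  · simp [L, ht]

end Hahn

/-! ### Totally ordered semifields and their groups of units -/

section Units

variable (K : Type u) [CommSemiring K] [IsTotOrd K]

open Classical in
/-- The canonical order on the group of units of a totally ordered semifield. -/
@[reducible] def unitsLinearOrder : LinearOrder Kˣ where
  le a b := CanonLE (a : K) b
  le_refl a := CanonLE.refl _
  le_trans _ _ _ h h' := h.trans h'
  le_antisymm _ _ h h' := Units.ext (h.antisymm h')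
  le_total a b := CanonLE.total _ _
  toDecidableLE := inferInstance

theorem isOrderedMonoid_units :
    let _ := unitsLinearOrder K
    IsOrderedMonoid Kˣ :=
  let _ := unitsLinearOrder K
  { mul_le_mul_left := fun _ _ h c => CanonLE.mul_right h (c : K) }

variable {K}

/-- A positive homomorphism on the units of a totally ordered semifield extends to the semifield. -/
theorem exists_ringHom_of_units [Nontrivial K] (hK : ∀ x : K, x ≠ 0 → IsUnit x) {H : Type*}
    [AddCommGroup H] [LinearOrder H] [IsOrderedAddMonoid H] (F : Additive Kˣ →+ H)
    (hF : ∀ x : Kˣ, CanonLT (1 : K) x → 0 < F (.ofMul x)) :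
    ∃ φ : K →+* MaxPlus H, Function.Injective φ ∧ ∀ x : Kˣ, φ x = MaxPlus.t (F (.ofMul x)) := by
  classical
  have hmono : ∀ x y : Kˣ, CanonLT (x : K) y → F (.ofMul x) < F (.ofMul y) := fun x y h => by
    have h1 : CanonLT (1 : K) ((y * x⁻¹ : Kˣ) : K) := by
      refine ⟨by simpa using h.1.mul_right ((x⁻¹ : Kˣ) : K), fun e => h.2 ?_⟩
      have : (1 : Kˣ) = y * x⁻¹ := Units.ext e
      rw [← eq_mul_inv_iff_mul_eq.1 this, one_mul]
    have h2 := hF _ h1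
    rw [ofMul_mul, ofMul_inv, map_add, map_neg] at h2
    exact sub_pos.1 (by simpa [sub_eq_add_neg] using h2)
  let φ : K → MaxPlus H := fun x => if h : x = 0 then 0 else MaxPlus.t (F (.ofMul (hK x h).unit))
  have h0 : φ 0 = 0 := dif_pos rfl
  have hu : ∀ x : Kˣ, φ x = MaxPlus.t (F (.ofMul x)) := fun x => by
    have : (hK x x.ne_zero).unit = x := Units.ext rfl
    simp only [φ, dif_neg x.ne_zero, this]
  have hle : ∀ x y : K, CanonLE x y → CanonLE (φ x) (φ y) := fun x y h => by
    by_cases hx : x = 0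
    · rw [hx, h0]
      exact CanonLE.zero_le _
    have hy : y ≠ 0 := fun hy => hx (hy ▸ h).eq_zero
    obtain ⟨x, rfl⟩ := hK x hx
    obtain ⟨y, rfl⟩ := hK y hy
    by_cases hxy : (x : K) = y
    · rw [hxy]
      exact CanonLE.refl _
    · rw [hu, hu, MaxPlus.canonLE_iff, MaxPlus.t_le_t]
      exact (hmono x y ⟨h, hxy⟩).le
  refine ⟨{ toFun := φ, map_zero' := h0, map_one' := ?_, map_mul' := fun x y => ?_,
            map_add' := fun x y => ?_ }, fun x y h => ?_, hu⟩
  · rw [← Units.val_one, hu, ofMul_one, map_zero, MaxPlus.t_zero]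
  · by_cases hx : x = 0
    · rw [hx, zero_mul, h0, zero_mul]
    by_cases hy : y = 0
    · rw [hy, mul_zero, h0, mul_zero]
    obtain ⟨x, rfl⟩ := hK x hx
    obtain ⟨y, rfl⟩ := hK y hy
    rw [← Units.val_mul, hu, hu, hu, ofMul_mul, map_add, MaxPlus.t_mul]
  · rcases CanonLE.total x y with h | h
    · rw [h]
      exact (hle x y h).symm
    · rw [add_comm, h, add_comm]
      exact (hle y x h).symm
  · have hinj : ∀ x y : K, CanonLE x y → φ x = φ y → x = y := fun x y h e => by
      by_contra hne
      have hy : y ≠ 0 := fun hy => hne ((hy ▸ h).eq_zero.trans hy.symm)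
      obtain ⟨y, rfl⟩ := hK y hy
      by_cases hx : x = 0
      · rw [hx, h0, hu] at e
        exact MaxPlus.t_ne_zero _ e.symm
      · obtain ⟨x, rfl⟩ := hK x hx
        rw [hu, hu] at e
        exact (hmono x y ⟨h, hne⟩).ne (MaxPlus.t_injective e)
    rcases CanonLE.total x y with h' | h'
    · exact hinj x y h' h
    · exact (hinj y x h' h.symm).symm

end Units

/-! ### Joint Hahn embeddings -/

section Joint

variable {S : Subsemiring Trop} {M : Type u} [AddCommMonoid M]
  {P : RingCon (AddMonoidAlgebra S M)}

/-- The residue semifield of a continuous prime embeds into `RLex I`, compatibly with `j`, for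
all `I` that contain a copy of its set `Ω` of Archimedean classes, above the least element. -/
theorem exists_residue_embedding (hS : IsSubsemifield S) (hSB : ∃ x ∈ S, x ≠ 0 ∧ x ≠ 1)
    (hP : P ∈ ContOver S (AddMonoidAlgebra S M)) :
    ∃ (Ω : Type u) (_ : LinearOrder Ω), ∀ (I : Type u) [LinearOrder I] [OrderBot I] (e : Ω ↪o I),
      (∀ i, e i ≠ ⊥) → ∃ φ : Residue P →+* RLex I, Function.Injective φ ∧
        ∀ s : S, φ (absVal P (algebraMap S (AddMonoidAlgebra S M) s)) = jMap I s := by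
  have := hP.1.isTotOrd_residue
  have := hP.1.nontrivial_residue
  let _ := unitsLinearOrder (Residue P)
  have := isOrderedMonoid_units (Residue P)
  set w : S →+* Residue P := (absVal P).comp (algebraMap S (AddMonoidAlgebra S M))
  have hwtm : ∀ s, w s = algebraMap _ (Residue P) (tm P 0 s) := fun s => by
    rw [← mk_algebraMap]
    rfl
  -- The group of all real numbers which belong to nonzero elements of `S`.
  let T : AddSubgroup ℝ :=
    { carrier := {a | MaxPlus.t a ∈ S}
      zero_mem' := S.one_mem
      add_mem' := fun ha hb => S.mul_mem ha hb
      neg_mem' := fun {a} ha => hS _ ha (MaxPlus.t_ne_zero a) }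
  have hunit : ∀ t : T, IsUnit (w ⟨MaxPlus.t (t : ℝ), t.2⟩) := fun t =>
    (hS.isUnit _ fun h => MaxPlus.t_ne_zero _ (congrArg Subtype.val h)).map w
  let ι : T →+ Additive (Residue P)ˣ :=
    { toFun := fun t => .ofMul (hunit t).unit
      map_zero' := by
        refine congrArg Additive.ofMul (Units.ext ?_)
        exact map_one w
      map_add' := fun a b => by
        refine congrArg Additive.ofMul (Units.ext ?_)
        exact map_mul w ⟨MaxPlus.t (a : ℝ), a.2⟩ ⟨MaxPlus.t (b : ℝ), b.2⟩ }
  have hιval : ∀ t : T, ((ι t).toMul : Residue P) = w ⟨MaxPlus.t (t : ℝ), t.2⟩ := fun t => rfl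
  have hlt : ∀ t : T, 0 < (t : ℝ) → CanonLT (1 : S) ⟨MaxPlus.t (t : ℝ), t.2⟩ := fun t ht => by
    refine ⟨canonLE_coe_iff.2 ?_, fun h => ht.ne (MaxPlus.t_injective (congrArg Subtype.val h))⟩
    exact MaxPlus.t_le_t.2 ht.le
  have hι : ∀ t : T, 0 < (t : ℝ) → 0 < ι t := fun t ht => by
    refine lt_of_le_of_ne ?_ fun h => ?_
    · change CanonLE (1 : Residue P) (w _)
      rw [← map_one w]
      exact CanonLE.map w (hlt t ht).1
    · have h' : (1 : Residue P) = w _ := congrArg (fun x => (x.toMul : Residue P)) h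
      rw [hwtm] at h'
      exact tm_ne_one hS hP (hlt t ht) (toResidue_injective P (h'.symm.trans (map_one _).symm))
  have hT : ∃ t : T, 0 < (t : ℝ) := by
    obtain ⟨d, hd⟩ := exists_one_canonLT hS hSB
    have hd0 : (d : Trop) ≠ 0 := by
      intro h
      have : d = 0 := Subtype.ext h
      subst this
      exact hd.2 hd.1.eq_zero
    obtain ⟨a, ha⟩ := MaxPlus.exists_eq_t hd0
    have h1 := canonLE_coe_iff.1 hd.1
    rw [ha] at h1
    refine ⟨⟨a, show MaxPlus.t a ∈ S from ha ▸ d.2⟩,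
      lt_of_le_of_ne (MaxPlus.t_le_t.1 h1) fun h => hd.2 (Subtype.ext ?_)⟩
    rw [ha, show a = 0 from h.symm]
    rfl
  have hcof : ∀ g : Additive (Residue P)ˣ, ∃ t : T, g ≤ ι t := fun g => by
    obtain ⟨b, N, -, hN, hbN⟩ := hP.1.exists_frac g.toMul.ne_zero
    obtain ⟨s, hs, hsb⟩ := exists_canonLE_tm hS hP (x := b) hN
    obtain ⟨a, ha⟩ := MaxPlus.exists_eq_t (x := (s : Trop)) fun h => hs (Subtype.ext h)
    have haS : MaxPlus.t a ∈ S := ha ▸ s.2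
    refine ⟨⟨a, haS⟩, ?_⟩
    change CanonLE (g.toMul : Residue P) (w _)
    rw [show (⟨MaxPlus.t a, haS⟩ : S) = s from Subtype.ext ha.symm, hwtm]
    refine canonLE_mul_cancel (c := algebraMap _ (Residue P) N)
      (fun x y h => (hP.1.isUnit_algebraMap hN).mul_left_cancel h) ?_
    rw [hbN, ← map_mul]
    exact canonLE_algebraMap_residue_iff.2 hsb
  refine ⟨FiniteArchimedeanClass (Additive (Residue P)ˣ), inferInstance, fun I _ _ e he => ?_⟩
  obtain ⟨F, hF, hFt⟩ := exists_hahn_embedding hι hT hcof e he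
  obtain ⟨φ, hφ, hφu⟩ := exists_ringHom_of_units (fun x => hP.1.isUnit_residue) F fun x hx =>
    hF _ (lt_of_le_of_ne hx.1 fun h => hx.2 (congrArg (fun x => (x.toMul : Residue P)) h))
  refine ⟨φ, hφ, fun s => ?_⟩
  by_cases hs : s = 0
  · rw [hs, map_zero, map_zero, map_zero]
    exact (MaxPlus.map_zero _).symm
  · obtain ⟨a, ha⟩ := MaxPlus.exists_eq_t (x := (s : Trop)) fun h => hs (Subtype.ext h)
    let t : T := ⟨a, show MaxPlus.t a ∈ S from ha ▸ s.2⟩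
    have hst : s = ⟨MaxPlus.t (t : ℝ), t.2⟩ := Subtype.ext ha
    change φ (w s) = _
    rw [ha, hst, ← hιval, hφu, ofMul_toMul, hFt]
    rfl

theorem nonempty_jointHahnEmbedding (hS : IsSubsemifield S) (hSB : ∃ x ∈ S, x ≠ 0 ∧ x ≠ 1)
    (hP : P ∈ ContOver S (AddMonoidAlgebra S M)) {P' : RingCon (AddMonoidAlgebra S M)}
    (hP' : P' ∈ ContOver S (AddMonoidAlgebra S M)) : Nonempty (JointHahnEmbedding S P P') := by
  obtain ⟨Ω, _, h⟩ := exists_residue_embedding hS hSB hP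
  obtain ⟨Ω', _, h'⟩ := exists_residue_embedding hS hSB hP'
  -- Both sets of Archimedean classes are put above a common least element.
  let e : Ω ↪o WithBot (Ω ⊕ₗ Ω') :=
    (OrderEmbedding.ofStrictMono _ Sum.Lex.inl_strictMono).trans WithBot.coeOrderHom
  let e' : Ω' ↪o WithBot (Ω ⊕ₗ Ω') :=
    (OrderEmbedding.ofStrictMono _ Sum.Lex.inr_strictMono).trans WithBot.coeOrderHom
  obtain ⟨φ, hφ, hφs⟩ := h _ e fun i => WithBot.coe_ne_bot
  obtain ⟨φ', hφ', hφs'⟩ := h' _ e' fun i => WithBot.coe_ne_bot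
  exact ⟨⟨_, φ, φ', hφ, hφ', hφs, hφs'⟩⟩

end Joint

end TropCont

end

open TropCont in
theorem mainTheorem1 (S : Subsemiring Trop) (hS : IsSubsemifield S)
    (hSB : ∃ x ∈ S, x ≠ 0 ∧ x ≠ 1) {M : Type*} [AddCommMonoid M] (hM : PseudoCancellative M)
    (P : ContOverInt S (AddMonoidAlgebra S M)) :
    (∀ P' ∈ ContOver S (AddMonoidAlgebra S M), Nonempty (JointHahnEmbedding S P.1 P')) ∧
    ∀ E : ∀ P' : ContOver S (AddMonoidAlgebra S M), JointHahnEmbedding S P.1 P'.1,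
      Set.BijOn (fun Q => Q.comap (Cnvg.incl P)) (ContSpec (Cnvg P))
        {P' | ∃ h : P' ∈ ContOver S (AddMonoidAlgebra S M), (E ⟨P', h⟩).Star} := by
  refine ⟨fun P' hP' => nonempty_jointHahnEmbedding hS hSB P.2.1 hP', fun E => ?_⟩
  have hset : {P' | ∃ h : P' ∈ ContOver S (AddMonoidAlgebra S M), (E ⟨P', h⟩).Star} =
      {P' | P' ∈ ContOver S (AddMonoidAlgebra S M) ∧ TermBound P.1 P'} := by
    ext P'
    simp only [Set.mem_ofPred_eq, (E _).star_iff hS hSB P.2, exists_prop]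
  rw [hset]
  exact Cnvg.bijOn_comap_incl hS.isUnit
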